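/- Let $\mathbf{H}_n^+$ denote the cone of $n\times n$ complex positive semidefinite matrices, and for $q>0$ put $\|A\|_q=\big(\mathrm{Tr}[(A^*A)^{q/2}]\big)^{1/q}$. For a matrix $A$ on $\mathbb{C}^m\otimes\mathbb{C}^n$, let $\mathrm{Tr}_2A$ be the $m\times m$ matrix with $\mathrm{Tr}[(\mathrm{Tr}_2A)C]=\mathrm{Tr}[A(C\otimes I_n)]$ for all $m\times m$ matrices $C$, and identify the positive semidefinite matrices on $\mathbb{C}^m\otimes\mathbb{C}^n$ with $\mathbf{H}_{mn}^+$. For $p,q>0$, positive integers $m,n$ and an $n\times n$ complex matrix $B$, define $$\Upsilon_{p,q}(A)=\mathrm{Tr}\big[(B^*A^pB)^{q/p}\big]\quad (A\in\mathbf{H}_n^+),$$ $$\Psi_{p,q}(A)=\big\|(\mathrm{Tr}_2A^p)^{1/p}\big\|_q\quad (A\in\mathbf{H}_{mn}^+),$$ $$\Phi_{p,q}(A_1,\dots,A_m)=\Big\|\Big(\sum_{j=1}^mA_j^p\Big)^{1/p}\Big\|_q\quad (A_1,\dots,A_m\in\mathbf{H}_n^+).$$ (1) If $1\le p\le 2$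 and $q\ge 1$, then for all $m,n\ge 1$ and every $B$, $\Upsilon_{p,q}$ is convex on $\mathbf{H}_n^+$, $\Psi_{p,q}$ is convex on $\mathbf{H}_{mn}^+$, and $\Phi_{p,q}$ is jointly convex on $(\mathbf{H}_n^+)^m$. (2) If $0<p\le q\le 1$, then for all $m,n\ge 1$ and every $B$, $\Upsilon_{p,q}$ is concave on $\mathbf{H}_n^+$, $\Psi_{p,q}$ is concave on $\mathbf{H}_{mn}^+$, and $\Phi_{p,q}$ is jointly concave on $(\mathbf{H}_n^+)^m$. (3) If $p>2$, $q>0$ and $q\ne p$, then none of these functions is in general convex or concave. Precisely: for every $n\ge 2$ there is an $n\times n$ matrix $B$ for which $\Upsilon_{p,q}$ is neither convex nor concave on $\mathbf{H}_n^+$; for all $m,n\ge 2$, $\Psi_{p,q}$ is neither convex nor concave on $\mathbf{H}_{mn}^+$; and for all $m,n\ge 2$, $\Phi_{p,q}$ is neither jointly convex nor jointly concave on $(\mathbf{H}_n^+)^m$, not even separately: for each $j$ there are fixed values in $\mathbf{H}_n^+$ of the arguments $A_i$, $i\ne j$, for which $A_j\mapsto\Phi_{p,q}(A_1,\dots,A_m)$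 is neither convex nor concave on $\mathbf{H}_n^+$. -/

import Mathlib

namespace TraceConvexity

open Matrix
open scoped MatrixOrder ComplexOrder Kronecker

noncomputable section

/-- The cone of complex positive semidefinite matrices with rows and columns indexed by `ι`. -/
def psdCone (ι : Type*) : Set (Matrix ι ι ℂ) := {A | A.PosSemidef}

/-- `‖A‖_q = (Tr[(A* A)^{q/2}])^{1/q}`. Matrix powers with real exponent are those of the continuous
functional calculus. The trace here is a nonnegative real number, whence the real part. -/
def schatten {ι : Type*} [Fintype ι] [DecidableEq ι] (q : ℝ) (A : Matrix ι ι ℂ) : ℝ :=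
  (Matrix.trace ((Aᴴ * A) ^ (q / 2))).re ^ (1 / q)

/-- The partial trace over the second factor of `ℂ^m ⊗ ℂ^n`, where matrices acting on this space
are indexed by pairs. -/
def partialTrace₂ {ι κ : Type*} [Fintype κ] (A : Matrix (ι × κ) (ι × κ) ℂ) : Matrix ι ι ℂ :=
  Matrix.of fun i j => ∑ k, A (i, k) (j, k)

/-- The defining duality of the partial trace: `Tr[(Tr₂ A) B] = Tr[A (B ⊗ I)]`. -/
theorem trace_partialTrace₂_mul {ι κ : Type*} [Fintype ι] [Fintype κ] [DecidableEq κ]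
    (A : Matrix (ι × κ) (ι × κ) ℂ) (B : Matrix ι ι ℂ) :
    Matrix.trace (partialTrace₂ A * B) =
      Matrix.trace (A * (B ⊗ₖ (1 : Matrix κ κ ℂ))) := by
  simp only [Matrix.trace, Matrix.diag_apply, Matrix.mul_apply, partialTrace₂, Matrix.of_apply,
    Fintype.sum_prod_type, Matrix.kroneckerMap_apply, Matrix.one_apply, mul_ite, mul_one, mul_zero,
    Finset.sum_ite_eq', Finset.mem_univ, if_true, Finset.sum_mul]
  exact Finset.sum_congr rfl fun i _ => Finset.sum_comm

/-- `Φ_{p,q}(A_1, …, A_m) = ‖(∑ A_j^p)^{1/p}‖_q`. -/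
def Phi (p q : ℝ) {m n : ℕ} (A : Fin m → Matrix (Fin n) (Fin n) ℂ) : ℝ :=
  schatten q ((∑ j, A j ^ p) ^ (1 / p))

/-- `Ψ_{p,q}(A) = ‖(Tr₂ A^p)^{1/p}‖_q`. -/
def Psi (p q : ℝ) {m n : ℕ} (A : Matrix (Fin m × Fin n) (Fin m × Fin n) ℂ) : ℝ :=
  schatten q (partialTrace₂ (A ^ p) ^ (1 / p))

/-- `Υ_{p,q}(A) = Tr[(B* A^p B)^{q/p}]`, for a fixed matrix `B`. -/
def Upsilon (p q : ℝ) {n : ℕ} (B A : Matrix (Fin n) (Fin n) ℂ) : ℝ :=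
  (Matrix.trace ((Bᴴ * A ^ p * B) ^ (q / p))).re

end

end TraceConvexity

/-! All three functionals come from one matrix, `congrSum`: S(A) = ∑ B_k* A_k^p B_k. For Υ there is
one term; for Φ every B_k is 1; for Ψ the partial trace is the sum of the compressions to the slices
ℂ^m ⊗ e_k. Parts (1) and (2) thus reduce to convexity or concavity of A ↦ Tr S(A)^r with r = q/p.
This function is homogeneous of degree q, and a nonnegative convex (concave) function homogeneous of
degree q has a convex (concave) q-th root, which gives the norms.

The trace is handled by Klein's inequality in variational form. For r ≥ 1, Tr S^r is the maximum
over Y of r Tr[S Y^(r-1)] - (r-1) Tr Y^r; for r ≤ 1 it is the infimum of r Tr[S Y^(r-1)] + (1-r) Tr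
Y^r over positive definite Y. If 1 ≤ p ≤ 2 and q ≥ p, a supremum of functions convex in A is convex.
Otherwise (apart from the trivial exponent r = 1 in part (2)) one substitutes Y = W^(1/w), with w
chosen so that Y^(r-1) = W^(1-p) and Y^r = W^u. The first term is then jointly convex in (A, W) by
Ando's theorem (`ando_convexity`), or jointly concave by Lieb's (`lieb_concavity`), and Tr W^u is
convex because u ≥ 1, which is exactly the condition q ≥ 1, respectively q ≤ 1. Partial minimisation
of a jointly convex function is convex, and partial maximisation of a jointly concave one is
concave.

Lieb's and Ando's theorems follow from integral representations of x^p, which reduce them to joint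
concavity of the parallel sum; that is a minimum over V of the functionals `parForm`, each linear in
(A, Z). Throughout, Tr[K* f(A) K g(Z)] is a double sum over eigenvalue pairs with nonnegative
weights (`jointSum`), so scalar inequalities become trace inequalities.

For part (3), X ↦ (X^p)_ii is not even quasiconvex when p > 2 (`exists_diagPow_lt`). Taking B to be
the projection on e_i settles Υ. For Φ, one other argument is frozen at C^(1/p) and the rest at 0;
to first order in X^p there remains Tr[X^p C^(q/p-1)], and since q ≠ p a diagonal C makes the weight
C^(q/p-1) nearly the projection on e_i. Block diagonal matrices carry the result from Φ to Ψ. -/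

namespace TraceConvexity

open Matrix
open scoped MatrixOrder ComplexOrder Kronecker

noncomputable section

/-! ### Spectral double sums and Klein's inequality -/

section

variable {ι κ : Type*} [Fintype ι] [Fintype κ] [DecidableEq ι] [DecidableEq κ]

/-- The sum of `φ a z` over the eigenvalues `a` of `A` and `z` of `Z`, weighted by the squared
moduli of the entries of `K` in the corresponding eigenbases. -/
def jointSum {A : Matrix ι ι ℂ} {Z : Matrix κ κ ℂ} (hA : A.IsHermitian) (hZ : Z.IsHermitian)
    (K : Matrix ι κ ℂ) (φ : ℝ → ℝ → ℝ) : ℝ :=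
  ∑ i, ∑ j, Complex.normSq
    (((hA.eigenvectorUnitary : Matrix ι ι ℂ)ᴴ * K * (hZ.eigenvectorUnitary : Matrix κ κ ℂ)) i j) *
      φ (hA.eigenvalues i) (hZ.eigenvalues j)

lemma cfc_eq_conj {A : Matrix ι ι ℂ} (hA : A.IsHermitian) (f : ℝ → ℝ) :
    cfc f A = (hA.eigenvectorUnitary : Matrix ι ι ℂ) *
      diagonal (fun i => ((f (hA.eigenvalues i) : ℝ) : ℂ)) *
        (hA.eigenvectorUnitary : Matrix ι ι ℂ)ᴴ := by
  rw [hA.cfc_eq, Matrix.IsHermitian.cfc, Unitary.conjStarAlgAut_apply]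
  rfl

lemma trace_conj_diagonal (N : Matrix ι κ ℂ) (f : ι → ℝ) (g : κ → ℝ) :
    (trace (Nᴴ * diagonal (fun i => (f i : ℂ)) * N * diagonal (fun j => (g j : ℂ)))).re =
      ∑ i, ∑ j, Complex.normSq (N i j) * (f i * g j) := by
  have h (j : κ) : (Nᴴ * diagonal (fun i => (f i : ℂ)) * N) j j =
      ∑ i, star (N i j) * (f i : ℂ) * N i j := by
    rw [Matrix.mul_apply]
    simp only [mul_diagonal, conjTranspose_apply]
  simp only [trace, diag_apply, mul_diagonal, h, Finset.sum_mul, Complex.re_sum]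
  rw [Finset.sum_comm]
  refine Finset.sum_congr rfl fun i _ => Finset.sum_congr rfl fun j _ => ?_
  simp only [Complex.normSq_apply, RCLike.star_def, Complex.mul_re, Complex.mul_im,
    Complex.conj_re, Complex.conj_im, Complex.ofReal_re, Complex.ofReal_im]
  ring

/-- Diagonalising both matrices leaves the squared moduli of the entries of K in the eigenbases as
weights. Together with `jointSum_mono` this lifts scalar inequalities in (a, z) to traces. -/
lemma re_trace_cfc_mul {A : Matrix ι ι ℂ} {Z : Matrix κ κ ℂ} (hA : A.IsHermitian)
    (hZ : Z.IsHermitian) (K : Matrix ι κ ℂ) (f g : ℝ → ℝ) :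
    (trace (Kᴴ * cfc f A * K * cfc g Z)).re = jointSum hA hZ K fun a z => f a * g z := by
  rw [jointSum, ← trace_conj_diagonal _ (fun i => f (hA.eigenvalues i))
    (fun j => g (hZ.eigenvalues j)), cfc_eq_conj hA, cfc_eq_conj hZ]
  simp only [conjTranspose_mul, conjTranspose_conjTranspose]
  congr 1
  simp only [← Matrix.mul_assoc]
  rw [Matrix.trace_mul_comm]
  simp only [Matrix.mul_assoc]

lemma cfc_id_of_isHermitian {A : Matrix ι ι ℂ} (hA : A.IsHermitian) : cfc (fun x : ℝ => x) A = A :=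
  cfc_id' ℝ A hA

lemma cfc_one_of_isHermitian {A : Matrix ι ι ℂ} (hA : A.IsHermitian) :
    cfc (fun _ : ℝ => (1 : ℝ)) A = 1 :=
  cfc_const_one ℝ A hA

lemma rpow_eq_cfc {A : Matrix ι ι ℂ} (hA : A.PosSemidef) (r : ℝ) :
    A ^ r = cfc (fun x : ℝ => x ^ r) A :=
  CFC.rpow_eq_cfc_real (nonneg_iff_posSemidef.mpr hA)

lemma rpow_posSemidef (A : Matrix ι ι ℂ) (r : ℝ) : (A ^ r).PosSemidef :=
  nonneg_iff_posSemidef.mp CFC.rpow_nonneg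

lemma jointSum_mono {A : Matrix ι ι ℂ} {Z : Matrix κ κ ℂ} (hA : A.IsHermitian) (hZ : Z.IsHermitian)
    (K : Matrix ι κ ℂ) {φ ψ : ℝ → ℝ → ℝ}
    (h : ∀ i j, φ (hA.eigenvalues i) (hZ.eigenvalues j) ≤ ψ (hA.eigenvalues i) (hZ.eigenvalues j)) :
    jointSum hA hZ K φ ≤ jointSum hA hZ K ψ :=
  Finset.sum_le_sum fun i _ => Finset.sum_le_sum fun j _ =>
    mul_le_mul_of_nonneg_left (h i j) (Complex.normSq_nonneg _)

lemma jointSum_add {A : Matrix ι ι ℂ} {Z : Matrix κ κ ℂ} (hA : A.IsHermitian) (hZ : Z.IsHermitian)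
    (K : Matrix ι κ ℂ) (φ ψ : ℝ → ℝ → ℝ) :
    jointSum hA hZ K (fun a z => φ a z + ψ a z) = jointSum hA hZ K φ + jointSum hA hZ K ψ := by
  simp only [jointSum, mul_add, Finset.sum_add_distrib]

lemma jointSum_mul {A : Matrix ι ι ℂ} {Z : Matrix κ κ ℂ} (hA : A.IsHermitian) (hZ : Z.IsHermitian)
    (K : Matrix ι κ ℂ) (c : ℝ) (φ : ℝ → ℝ → ℝ) :
    jointSum hA hZ K (fun a z => c * φ a z) = c * jointSum hA hZ K φ := by
  simp only [jointSum, Finset.mul_sum]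
  exact Finset.sum_congr rfl fun i _ => Finset.sum_congr rfl fun j _ => by ring

lemma re_trace_rpow_mul_rpow {A : Matrix ι ι ℂ} {Z : Matrix κ κ ℂ} (hA : A.PosSemidef)
    (hZ : Z.PosSemidef) (K : Matrix ι κ ℂ) (r s : ℝ) :
    (trace (Kᴴ * A ^ r * K * Z ^ s)).re =
      jointSum hA.isHermitian hZ.isHermitian K fun a z => a ^ r * z ^ s := by
  rw [rpow_eq_cfc hA, rpow_eq_cfc hZ, re_trace_cfc_mul]

lemma re_trace_rpow_left {A : Matrix ι ι ℂ} {Z : Matrix κ κ ℂ} (hA : A.PosSemidef)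
    (hZ : Z.PosSemidef) (K : Matrix ι κ ℂ) (r : ℝ) :
    (trace (Kᴴ * A ^ r * K)).re = jointSum hA.isHermitian hZ.isHermitian K fun a _ => a ^ r := by
  have := re_trace_cfc_mul hA.isHermitian hZ.isHermitian K (fun x => x ^ r) (fun _ => 1)
  rw [cfc_one_of_isHermitian hZ.isHermitian, ← rpow_eq_cfc hA, Matrix.mul_one] at this
  simpa using this

lemma re_trace_rpow_right {A : Matrix ι ι ℂ} {Z : Matrix κ κ ℂ} (hA : A.PosSemidef)
    (hZ : Z.PosSemidef) (K : Matrix ι κ ℂ) (s : ℝ) :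
    (trace (Kᴴ * K * Z ^ s)).re = jointSum hA.isHermitian hZ.isHermitian K fun _ z => z ^ s := by
  have := re_trace_cfc_mul hA.isHermitian hZ.isHermitian K (fun _ => 1) (fun x => x ^ s)
  rw [cfc_one_of_isHermitian hA.isHermitian, ← rpow_eq_cfc hZ, Matrix.mul_one] at this
  simpa using this

/-- The scalar form of Young's inequality behind Klein's inequality, for exponents at least `1`. -/
lemma mul_rpow_sub_one_le {x y r : ℝ} (hx : 0 ≤ x) (hy : 0 ≤ y) (hr : 1 ≤ r) :
    r * (x * y ^ (r - 1)) ≤ x ^ r + (r - 1) * y ^ r := by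
  rcases hr.eq_or_lt with rfl | hr
  · simp
  rcases hy.eq_or_lt with rfl | hy
  · rw [Real.zero_rpow (by linarith), Real.zero_rpow (by linarith)]
    simpa using Real.rpow_nonneg hx r
  have h := one_add_mul_self_le_rpow_one_add (s := x / y - 1) (by
    have := div_nonneg hx hy.le; linarith) hr.le
  have e : (1 + (x / y - 1)) ^ r = x ^ r / y ^ r := by
    rw [← Real.div_rpow hx hy.le]; ring_nf
  have hyr : 0 < y ^ r := Real.rpow_pos_of_pos hy r
  rw [e, le_div_iff₀ hyr] at h
  rw [Real.rpow_sub_one hy.ne']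
  calc r * (x * (y ^ r / y)) = (1 + r * (x / y - 1)) * y ^ r + (r - 1) * y ^ r := by
        field_simp; ring
    _ ≤ _ := by gcongr

/-- The scalar form of Young's inequality behind Klein's inequality, for exponents at most `1`. -/
lemma rpow_le_mul_rpow_sub_one {x y r : ℝ} (hx : 0 ≤ x) (hy : 0 < y) (hr0 : 0 ≤ r) (hr : r ≤ 1) :
    x ^ r ≤ r * (x * y ^ (r - 1)) + (1 - r) * y ^ r := by
  have h := rpow_one_add_le_one_add_mul_self (s := x / y - 1) (by
    have := div_nonneg hx hy.le; linarith) hr0 hr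
  have e : (1 + (x / y - 1)) ^ r = x ^ r / y ^ r := by
    rw [← Real.div_rpow hx hy.le]; ring_nf
  have hyr : 0 < y ^ r := Real.rpow_pos_of_pos hy r
  rw [e, div_le_iff₀ hyr] at h
  rw [Real.rpow_sub_one hy.ne']
  calc x ^ r ≤ (1 + r * (x / y - 1)) * y ^ r := h
    _ = _ := by field_simp; ring

/-- The trace functional `Tr X^r`. -/
def trPow (r : ℝ) (X : Matrix ι ι ℂ) : ℝ := (trace (X ^ r)).re

lemma trPow_eq_left {X Y : Matrix ι ι ℂ} (hX : X.PosSemidef) (hY : Y.PosSemidef) (r : ℝ) :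
    trPow r X = jointSum hX.isHermitian hY.isHermitian 1 fun x _ => x ^ r := by
  rw [← re_trace_rpow_left hX hY 1 r]; simp [trPow]

lemma trPow_eq_right {X Y : Matrix ι ι ℂ} (hX : X.PosSemidef) (hY : Y.PosSemidef) (r : ℝ) :
    trPow r Y = jointSum hX.isHermitian hY.isHermitian 1 fun _ y => y ^ r := by
  rw [← re_trace_rpow_right hX hY 1 r]; simp [trPow]

lemma re_trace_mul_rpow {X Y : Matrix ι ι ℂ} (hX : X.PosSemidef) (hY : Y.PosSemidef) (r : ℝ) :
    (trace (X * Y ^ r)).re = jointSum hX.isHermitian hY.isHermitian 1 fun x y => x * y ^ r := by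
  have := re_trace_rpow_mul_rpow hX hY 1 1 r
  simpa [CFC.rpow_one X (nonneg_iff_posSemidef.mpr hX)] using this

lemma rpow_mul_rpow {X : Matrix ι ι ℂ} (hX : X.PosSemidef) {r s : ℝ} (hr : 0 ≤ r) (hs : 0 ≤ s) :
    X ^ r * X ^ s = X ^ (r + s) := by
  rw [rpow_eq_cfc hX, rpow_eq_cfc hX, rpow_eq_cfc hX, cfc_eq_conj hX.isHermitian,
    cfc_eq_conj hX.isHermitian, cfc_eq_conj hX.isHermitian]
  set U := (hX.isHermitian.eigenvectorUnitary : Matrix ι ι ℂ)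
  have hU : Uᴴ * U = 1 := Unitary.coe_star_mul_self hX.isHermitian.eigenvectorUnitary
  rw [Matrix.mul_assoc, ← Matrix.mul_assoc (Uᴴ), ← Matrix.mul_assoc (Uᴴ), hU, Matrix.one_mul,
    Matrix.mul_assoc U, ← Matrix.mul_assoc (diagonal _), diagonal_mul_diagonal, Matrix.mul_assoc U]
  congr! 4 with i
  rw [← Complex.ofReal_mul, Real.rpow_add_of_nonneg (hX.eigenvalues_nonneg i) hr hs]

/-- Klein's inequality for exponents at least `1`. -/
lemma klein_of_one_le {X Y : Matrix ι ι ℂ} (hX : X.PosSemidef) (hY : Y.PosSemidef) {r : ℝ}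
    (hr : 1 ≤ r) : r * (trace (X * Y ^ (r - 1))).re ≤ trPow r X + (r - 1) * trPow r Y := by
  rw [re_trace_mul_rpow hX hY, trPow_eq_left hX hY, trPow_eq_right hX hY, ← jointSum_mul,
    ← jointSum_mul, ← jointSum_add]
  exact jointSum_mono _ _ _ fun i j =>
    mul_rpow_sub_one_le (hX.eigenvalues_nonneg i) (hY.eigenvalues_nonneg j) hr

/-- Klein's inequality for exponents at most `1`. -/
lemma klein_of_le_one {X Y : Matrix ι ι ℂ} (hX : X.PosSemidef) (hY : Y.PosDef) {r : ℝ}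
    (hr0 : 0 ≤ r) (hr : r ≤ 1) :
    trPow r X ≤ r * (trace (X * Y ^ (r - 1))).re + (1 - r) * trPow r Y := by
  rw [re_trace_mul_rpow hX hY.posSemidef, trPow_eq_left hX hY.posSemidef,
    trPow_eq_right hX hY.posSemidef, ← jointSum_mul, ← jointSum_mul, ← jointSum_add]
  exact jointSum_mono _ _ _ fun i j =>
    rpow_le_mul_rpow_sub_one (hX.eigenvalues_nonneg i) (hY.eigenvalues_pos j) hr0 hr

lemma posSemidef_combo {μ : Type*} {X Y : Matrix μ μ ℂ} (hX : X.PosSemidef) (hY : Y.PosSemidef)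
    {a b : ℝ} (ha : 0 ≤ a) (hb : 0 ≤ b) : (a • X + b • Y).PosSemidef :=
  (hX.smul ha).add (hY.smul hb)

lemma re_trace_mul_rpow_sub_one {X : Matrix ι ι ℂ} (hX : X.PosSemidef) {r : ℝ} (hr : 1 ≤ r) :
    (trace (X * X ^ (r - 1))).re = trPow r X := by
  have := rpow_mul_rpow hX zero_le_one (sub_nonneg.mpr hr)
  rw [CFC.rpow_one X (nonneg_iff_posSemidef.mpr hX), add_sub_cancel] at this
  rw [this, trPow]

/-- Klein's inequality based at the combination M is a supporting hyperplane of Tr X^r at M;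
averaging it over the two endpoints gives convexity. -/
lemma trPow_convex {X Y : Matrix ι ι ℂ} (hX : X.PosSemidef) (hY : Y.PosSemidef) {a b r : ℝ}
    (ha : 0 ≤ a) (hb : 0 ≤ b) (hab : a + b = 1) (hr : 1 ≤ r) :
    trPow r (a • X + b • Y) ≤ a * trPow r X + b * trPow r Y := by
  have hM := posSemidef_combo hX hY ha hb
  set M := a • X + b • Y with hMdef
  have h1 := klein_of_one_le hX hM hr
  have h2 := klein_of_one_le hY hM hr
  have h3 : trPow r M = a * (trace (X * M ^ (r - 1))).re + b * (trace (Y * M ^ (r - 1))).re := by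
    rw [← re_trace_mul_rpow_sub_one hM hr]
    conv_lhs => rw [hMdef, ← hMdef]
    nth_rewrite 1 [hMdef]
    simp [Matrix.add_mul, trace_add]
  have hb' : b = 1 - a := by linarith
  subst hb'
  nlinarith [mul_le_mul_of_nonneg_left h1 ha, mul_le_mul_of_nonneg_left h2 hb]

end

/-! ### Parallel sums and the theorems of Lieb and Ando -/

section

variable {ι κ : Type*} [Fintype ι] [Fintype κ] [DecidableEq ι] [DecidableEq κ]

/-- The scalar kernel `a z / (a + t z)`, a rescaled parallel sum of `a` and `t z`. -/
def parKernel (t a z : ℝ) : ℝ := a * z / (a + t * z)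

/-- Completing the square: after multiplication by a + tz, the two sides differ by |a(k - v) -
tzv|². -/
lemma normSq_mul_parKernel_le (k v : ℂ) {t a z : ℝ} (ht : 0 < t) (ha : 0 ≤ a) (hz : 0 ≤ z) :
    Complex.normSq k * (t * parKernel t a z) ≤
      Complex.normSq (k - v) * a + t * (Complex.normSq v * z) := by
  have hz' : 0 ≤ t * z := mul_nonneg ht.le hz
  have h1 := Complex.normSq_nonneg (k - v)
  have h2 := Complex.normSq_nonneg v
  rcases (add_nonneg ha hz').eq_or_lt with h | h
  · rw [parKernel, ← h, div_zero, mul_zero, mul_zero]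
    positivity
  · rw [parKernel, mul_div_assoc', mul_div_assoc', div_le_iff₀ h]
    have := add_nonneg (sq_nonneg (a * (k - v).re - t * z * v.re))
      (sq_nonneg (a * (k - v).im - t * z * v.im))
    simp only [Complex.normSq_apply, Complex.sub_re, Complex.sub_im] at *
    nlinarith [this]

/-- The square in `normSq_mul_parKernel_le` vanishes at v = ak/(a + tz). -/
lemma normSq_mul_parKernel_eq (k : ℂ) {t a z : ℝ} (ht : 0 < t) (ha : 0 ≤ a) (hz : 0 ≤ z) :
    Complex.normSq (k - ((a / (a + t * z) : ℝ) : ℂ) * k) * a +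
      t * (Complex.normSq (((a / (a + t * z) : ℝ) : ℂ) * k) * z) =
        Complex.normSq k * (t * parKernel t a z) := by
  have hz' : 0 ≤ t * z := mul_nonneg ht.le hz
  rcases (add_nonneg ha hz').eq_or_lt with h | h
  · have h0 : a = 0 := by linarith
    simp [parKernel, h0]
  · have : k - ((a / (a + t * z) : ℝ) : ℂ) * k = ((t * z / (a + t * z) : ℝ) : ℂ) * k := by
      rw [← sub_eq_zero]
      have : ((a / (a + t * z) : ℝ) : ℂ) = 1 - ((t * z / (a + t * z) : ℝ) : ℂ) := by
        rw [← Complex.ofReal_one, ← Complex.ofReal_sub]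
        congr 1
        field_simp
        ring
      rw [this]; ring
    rw [this, Complex.normSq_mul, Complex.normSq_mul, Complex.normSq_ofReal, Complex.normSq_ofReal,
      parKernel]
    field_simp
    ring

/-- The quadratic functional whose minimum over `V` is the parallel sum. -/
def parForm {ι κ : Type*} [Fintype ι] [Fintype κ] (t : ℝ) (K V : Matrix ι κ ℂ)
    (A : Matrix ι ι ℂ) (Z : Matrix κ κ ℂ) : ℝ :=
  (trace ((K - V)ᴴ * A * (K - V))).re + t * (trace (Vᴴ * V * Z)).re

lemma parForm_eq {A : Matrix ι ι ℂ} {Z : Matrix κ κ ℂ} (hA : A.IsHermitian) (hZ : Z.IsHermitian)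
    (t : ℝ) (K V : Matrix ι κ ℂ) :
    parForm t K V A Z = ∑ i, ∑ j,
      (Complex.normSq (
        ((hA.eigenvectorUnitary : Matrix ι ι ℂ)ᴴ * K * (hZ.eigenvectorUnitary : Matrix κ κ ℂ)) i j -
        ((hA.eigenvectorUnitary : Matrix ι ι ℂ)ᴴ * V * (hZ.eigenvectorUnitary : Matrix κ κ ℂ)) i j)
          * hA.eigenvalues i +
        t * (Complex.normSq (((hA.eigenvectorUnitary : Matrix ι ι ℂ)ᴴ * V *
          (hZ.eigenvectorUnitary : Matrix κ κ ℂ)) i j) * hZ.eigenvalues j)) := by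
  have h1 := re_trace_cfc_mul hA hZ (K - V) (fun x => x) (fun _ => 1)
  have h2 := re_trace_cfc_mul hA hZ V (fun _ => 1) (fun x => x)
  rw [cfc_one_of_isHermitian hZ, cfc_id_of_isHermitian hA, Matrix.mul_one] at h1
  rw [cfc_one_of_isHermitian hA, cfc_id_of_isHermitian hZ, Matrix.mul_one] at h2
  rw [parForm, h1, h2]
  simp only [jointSum, Finset.mul_sum, Finset.sum_add_distrib, mul_one, one_mul, Matrix.mul_sub,
    Matrix.sub_mul, Matrix.sub_apply]

lemma jointSum_parKernel_le_parForm {A : Matrix ι ι ℂ} {Z : Matrix κ κ ℂ} (hA : A.PosSemidef)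
    (hZ : Z.PosSemidef) {t : ℝ} (ht : 0 < t) (K V : Matrix ι κ ℂ) :
    t * jointSum hA.isHermitian hZ.isHermitian K (parKernel t) ≤ parForm t K V A Z := by
  rw [← jointSum_mul, parForm_eq hA.isHermitian hZ.isHermitian]
  exact Finset.sum_le_sum fun i _ => Finset.sum_le_sum fun j _ => normSq_mul_parKernel_le _ _ ht
    (hA.eigenvalues_nonneg i) (hZ.eigenvalues_nonneg j)

lemma exists_parForm_eq {A : Matrix ι ι ℂ} {Z : Matrix κ κ ℂ} (hA : A.PosSemidef)
    (hZ : Z.PosSemidef) {t : ℝ} (ht : 0 < t) (K : Matrix ι κ ℂ) :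
    ∃ V, parForm t K V A Z = t * jointSum hA.isHermitian hZ.isHermitian K (parKernel t) := by
  set U := (hA.isHermitian.eigenvectorUnitary : Matrix ι ι ℂ) with hU
  set W := (hZ.isHermitian.eigenvectorUnitary : Matrix κ κ ℂ) with hW
  have hUU : Uᴴ * U = 1 := Unitary.coe_star_mul_self hA.isHermitian.eigenvectorUnitary
  have hWW : Wᴴ * W = 1 := Unitary.coe_star_mul_self hZ.isHermitian.eigenvectorUnitary
  -- The scalar minimiser, entry by entry in the eigenbases.
  let N : Matrix ι κ ℂ := Matrix.of fun i j =>
    ((hA.isHermitian.eigenvalues i / (hA.isHermitian.eigenvalues i +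
      t * hZ.isHermitian.eigenvalues j) : ℝ) : ℂ) * (Uᴴ * K * W) i j
  have hN : Uᴴ * (U * N * Wᴴ) * W = N := by
    rw [Matrix.mul_assoc, Matrix.mul_assoc (U * N), hWW, Matrix.mul_one, ← Matrix.mul_assoc, hUU,
      Matrix.one_mul]
  refine ⟨U * N * Wᴴ, ?_⟩
  rw [← jointSum_mul, parForm_eq hA.isHermitian hZ.isHermitian, ← hU, ← hW, hN, jointSum]
  exact Finset.sum_congr rfl fun i _ => Finset.sum_congr rfl fun j _ =>
    normSq_mul_parKernel_eq _ ht (hA.eigenvalues_nonneg i) (hZ.eigenvalues_nonneg j)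

lemma parForm_combo {ι κ : Type*} [Fintype ι] [Fintype κ] (t : ℝ) (K V : Matrix ι κ ℂ)
    (A A' : Matrix ι ι ℂ) (Z Z' : Matrix κ κ ℂ)
    (a b : ℝ) : parForm t K V (a • A + b • A') (a • Z + b • Z') =
      a * parForm t K V A Z + b * parForm t K V A' Z' := by
  simp only [parForm, Matrix.mul_add, Matrix.add_mul, Matrix.mul_smul, Matrix.smul_mul, trace_add,
    trace_smul, Complex.add_re, Complex.smul_re, smul_eq_mul]
  ring

/-- Joint concavity of the parallel sum. -/
lemma jointSum_parKernel_concave {A A' : Matrix ι ι ℂ} {Z Z' : Matrix κ κ ℂ} (hA : A.PosSemidef)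
    (hA' : A'.PosSemidef) (hZ : Z.PosSemidef) (hZ' : Z'.PosSemidef) {a b t : ℝ} (ha : 0 ≤ a)
    (hb : 0 ≤ b) (ht : 0 < t) (K : Matrix ι κ ℂ) :
    a * jointSum hA.isHermitian hZ.isHermitian K (parKernel t) +
      b * jointSum hA'.isHermitian hZ'.isHermitian K (parKernel t) ≤
    jointSum (posSemidef_combo hA hA' ha hb).isHermitian
      (posSemidef_combo hZ hZ' ha hb).isHermitian K (parKernel t) := by
  -- V is optimal for the combination and merely admissible for the two endpoints, while `parForm`
  -- is linear in (A, Z) for fixed V.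
  obtain ⟨V, hV⟩ := exists_parForm_eq (posSemidef_combo hA hA' ha hb)
    (posSemidef_combo hZ hZ' ha hb) ht K
  rw [parForm_combo] at hV
  have h1 := mul_le_mul_of_nonneg_left (jointSum_parKernel_le_parForm hA hZ ht K V) ha
  have h2 := mul_le_mul_of_nonneg_left (jointSum_parKernel_le_parForm hA' hZ' ht K V) hb
  refine le_of_mul_le_mul_left ?_ ht
  rw [← hV]
  linarith

open MeasureTheory Set

lemma jointSum_integral {A : Matrix ι ι ℂ} {Z : Matrix κ κ ℂ} (hA : A.IsHermitian)
    (hZ : Z.IsHermitian) (K : Matrix ι κ ℂ) (μ : Measure ℝ) (F : ℝ → ℝ → ℝ → ℝ) (φ : ℝ → ℝ → ℝ)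
    (h : ∀ i j, IntegrableOn (fun t => F t (hA.eigenvalues i) (hZ.eigenvalues j)) (Ioi 0) μ ∧
      φ (hA.eigenvalues i) (hZ.eigenvalues j) =
        ∫ t in Ioi 0, F t (hA.eigenvalues i) (hZ.eigenvalues j) ∂μ) :
    IntegrableOn (fun t => jointSum hA hZ K (F t)) (Ioi 0) μ ∧
      jointSum hA hZ K φ = ∫ t in Ioi 0, jointSum hA hZ K (F t) ∂μ := by
  refine ⟨integrable_finsetSum _ fun i _ => integrable_finsetSum _ fun j _ =>
    (h i j).1.const_mul _, ?_⟩
  simp only [jointSum]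
  rw [integral_finsetSum _ fun i _ => integrable_finsetSum _ fun j _ => (h i j).1.const_mul _]
  refine Finset.sum_congr rfl fun i _ => ?_
  rw [integral_finsetSum _ fun j _ => (h i j).1.const_mul _]
  refine Finset.sum_congr rfl fun j _ => ?_
  rw [(h i j).2, integral_const_mul]

lemma rpow_mul_rpow_one_sub {a z p : ℝ} (ha : 0 ≤ a) (hz : 0 < z) :
    a ^ p * z ^ (1 - p) = z * (a / z) ^ p := by
  rw [Real.rpow_sub hz, Real.rpow_one, Real.div_rpow ha hz.le]
  ring

/-- The integral representation of x^p at x = a/z, multiplied by z. At z = 0 both sides vanish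
because 1 - p > 0, so singular Z is allowed. -/
lemma exists_measure_rpow_mul_rpow_of_lt_one {p : ℝ} (hp : p ∈ Ioo (0 : ℝ) 1) :
    ∃ μ : Measure ℝ, ∀ a z : ℝ, 0 ≤ a → 0 ≤ z →
      IntegrableOn (fun t => t ^ (p - 1) * parKernel t a z) (Ioi 0) μ ∧
      a ^ p * z ^ (1 - p) = ∫ t in Ioi 0, t ^ (p - 1) * parKernel t a z ∂μ := by
  obtain ⟨μ, hμ⟩ := Real.exists_measure_rpow_eq_integral_rpowIntegrand₀₁ hp
  refine ⟨μ, fun a z ha hz => ?_⟩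
  rcases hz.eq_or_lt with rfl | hz
  · simp [parKernel, Real.zero_rpow (sub_pos.mpr hp.2).ne']
  · obtain ⟨h1, h2⟩ := hμ (a / z) (div_nonneg ha hz.le)
    have e : EqOn (fun t => z * Real.rpowIntegrand₀₁ p t (a / z))
        (fun t => t ^ (p - 1) * parKernel t a z) (Ioi 0) := by
      intro t ht
      have ht : 0 < t := ht
      have h3 : 0 < a + t * z := by positivity
      have h4 : t + a / z = (a + t * z) / z := by field_simp; ring
      simp only
      rw [Real.rpowIntegrand₀₁_eq_pow_div hp ht.le (div_nonneg ha hz.le), h4, parKernel]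
      field_simp
    refine ⟨IntegrableOn.congr_fun (h1.const_mul z) e measurableSet_Ioi, ?_⟩
    rw [rpow_mul_rpow_one_sub ha hz, h2, ← setIntegral_congr_fun measurableSet_Ioi e,
      integral_const_mul]

/-- As for p < 1, but now the parallel sum enters with a negative sign next to a term linear in a:
concavity of the parallel sum turns into convexity. -/
lemma exists_measure_rpow_mul_rpow_of_one_lt {p : ℝ} (hp : p ∈ Ioo (1 : ℝ) 2) :
    ∃ μ : Measure ℝ, ∀ a z : ℝ, 0 ≤ a → 0 < z →
      IntegrableOn (fun t => t ^ (p - 2) * (a + (-t) * parKernel t a z)) (Ioi 0) μ ∧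
      a ^ p * z ^ (1 - p) = ∫ t in Ioi 0, t ^ (p - 2) * (a + (-t) * parKernel t a z) ∂μ := by
  obtain ⟨μ, hμ⟩ := Real.exists_measure_rpow_eq_integral_rpowIntegrand₁₂ hp
  refine ⟨μ, fun a z ha hz => ?_⟩
  obtain ⟨h1, h2⟩ := hμ (a / z) (div_nonneg ha hz.le)
  have e : EqOn (fun t => z * Real.rpowIntegrand₁₂ p t (a / z))
      (fun t => t ^ (p - 2) * (a + (-t) * parKernel t a z)) (Ioi 0) := by
    intro t ht
    have ht : 0 < t := ht
    have h3 : 0 < a + t * z := by positivity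
    have h4 : t + a / z = (a + t * z) / z := by field_simp; ring
    have h5 : t ^ (p - 1) = t ^ (p - 2) * t := by
      rw [← Real.rpow_add_one ht.ne']; ring_nf
    simp only [Real.rpowIntegrand₁₂, parKernel]
    rw [h4, h5]
    field_simp
    ring
  refine ⟨IntegrableOn.congr_fun (h1.const_mul z) e measurableSet_Ioi, ?_⟩
  rw [rpow_mul_rpow_one_sub ha hz, h2, ← setIntegral_congr_fun measurableSet_Ioi e,
    integral_const_mul]

/-- Lieb's concavity theorem for `Tr[K* A^p K Z^{1-p}]`. -/
theorem lieb_concavity {A A' : Matrix ι ι ℂ} {Z Z' : Matrix κ κ ℂ} (hA : A.PosSemidef)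
    (hA' : A'.PosSemidef) (hZ : Z.PosSemidef) (hZ' : Z'.PosSemidef) {a b p : ℝ} (ha : 0 ≤ a)
    (hb : 0 ≤ b) (hp : p ∈ Ioo (0 : ℝ) 1) (K : Matrix ι κ ℂ) :
    a * (trace (Kᴴ * A ^ p * K * Z ^ (1 - p))).re +
      b * (trace (Kᴴ * A' ^ p * K * Z' ^ (1 - p))).re ≤
    (trace (Kᴴ * (a • A + b • A') ^ p * K * (a • Z + b • Z') ^ (1 - p))).re := by
  have hAm := posSemidef_combo hA hA' ha hb
  have hZm := posSemidef_combo hZ hZ' ha hb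
  obtain ⟨μ, hμ⟩ := exists_measure_rpow_mul_rpow_of_lt_one hp
  have key {B : Matrix ι ι ℂ} {Y : Matrix κ κ ℂ} (hB : B.PosSemidef) (hY : Y.PosSemidef) :=
    jointSum_integral hB.isHermitian hY.isHermitian K μ
      (fun t a z => t ^ (p - 1) * parKernel t a z) (fun a z => a ^ p * z ^ (1 - p))
      fun i j => hμ _ _ (hB.eigenvalues_nonneg i) (hY.eigenvalues_nonneg j)
  rw [re_trace_rpow_mul_rpow hA hZ, re_trace_rpow_mul_rpow hA' hZ',
    re_trace_rpow_mul_rpow hAm hZm, (key hA hZ).2, (key hA' hZ').2, (key hAm hZm).2,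
    ← integral_const_mul, ← integral_const_mul,
    ← integral_add ((key hA hZ).1.const_mul a) ((key hA' hZ').1.const_mul b)]
  refine setIntegral_mono_on (((key hA hZ).1.const_mul a).add ((key hA' hZ').1.const_mul b))
    (key hAm hZm).1 measurableSet_Ioi fun t ht => ?_
  have := mul_le_mul_of_nonneg_left (jointSum_parKernel_concave hA hA' hZ hZ' ha hb ht K)
    (Real.rpow_nonneg (le_of_lt ht) (p - 1))
  simp only [jointSum_mul]
  linarith

lemma jointSum_fst {A : Matrix ι ι ℂ} {Z : Matrix κ κ ℂ} (hA : A.IsHermitian) (hZ : Z.IsHermitian)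
    (K : Matrix ι κ ℂ) : jointSum hA hZ K (fun a _ => a) = (trace (Kᴴ * A * K)).re := by
  have h1 := re_trace_cfc_mul hA hZ K (fun x => x) (fun _ => 1)
  rw [cfc_one_of_isHermitian hZ, cfc_id_of_isHermitian hA, Matrix.mul_one] at h1
  simpa using h1.symm

lemma ando_convexity_of_mem_Ioo {A A' : Matrix ι ι ℂ} {Z Z' : Matrix κ κ ℂ} (hA : A.PosSemidef)
    (hA' : A'.PosSemidef) (hZ : Z.PosDef) (hZ' : Z'.PosDef) {a b p : ℝ} (ha : 0 ≤ a)
    (hb : 0 ≤ b) (hZm : (a • Z + b • Z').PosDef) (hp : p ∈ Ioo (1 : ℝ) 2) (K : Matrix ι κ ℂ) :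
    (trace (Kᴴ * (a • A + b • A') ^ p * K * (a • Z + b • Z') ^ (1 - p))).re ≤
      a * (trace (Kᴴ * A ^ p * K * Z ^ (1 - p))).re +
        b * (trace (Kᴴ * A' ^ p * K * Z' ^ (1 - p))).re := by
  have hAm := posSemidef_combo hA hA' ha hb
  obtain ⟨μ, hμ⟩ := exists_measure_rpow_mul_rpow_of_one_lt hp
  have key {B : Matrix ι ι ℂ} {Y : Matrix κ κ ℂ} (hB : B.PosSemidef) (hY : Y.PosDef) :=
    jointSum_integral hB.isHermitian hY.isHermitian K μ
      (fun t a z => t ^ (p - 2) * (a + (-t) * parKernel t a z)) (fun a z => a ^ p * z ^ (1 - p))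
      fun i j => hμ _ _ (hB.eigenvalues_nonneg i) (hY.eigenvalues_pos j)
  rw [re_trace_rpow_mul_rpow hA hZ.posSemidef, re_trace_rpow_mul_rpow hA' hZ'.posSemidef,
    re_trace_rpow_mul_rpow hAm hZm.posSemidef, (key hA hZ).2, (key hA' hZ').2, (key hAm hZm).2,
    ← integral_const_mul, ← integral_const_mul,
    ← integral_add ((key hA hZ).1.const_mul a) ((key hA' hZ').1.const_mul b)]
  refine setIntegral_mono_on (key hAm hZm).1
    (((key hA hZ).1.const_mul a).add ((key hA' hZ').1.const_mul b)) measurableSet_Ioi fun t ht => ?_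
  have ht : 0 < t := ht
  have h1 := mul_le_mul_of_nonneg_left (jointSum_parKernel_concave hA hA' hZ.posSemidef
    hZ'.posSemidef ha hb ht K) ht.le
  have h2 : (trace (Kᴴ * (a • A + b • A') * K)).re =
      a * (trace (Kᴴ * A * K)).re + b * (trace (Kᴴ * A' * K)).re := by
    simp [Matrix.mul_add, Matrix.add_mul, trace_add]
  simp only [jointSum_mul, jointSum_add, jointSum_fst, h2]
  have h3 := Real.rpow_nonneg ht.le (p - 2)
  rw [← sub_nonneg]
  refine (mul_nonneg h3 (sub_nonneg.mpr h1)).trans_eq ?_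
  ring

lemma posDef_combo {μ : Type*} {X Y : Matrix μ μ ℂ} (hX : X.PosDef) (hY : Y.PosDef) {a b : ℝ}
    (ha : 0 ≤ a) (hb : 0 ≤ b) (hab : a + b = 1) : (a • X + b • Y).PosDef := by
  rcases ha.eq_or_lt with rfl | ha
  · obtain rfl : b = 1 := by linarith
    simpa using hY
  · exact (hX.smul ha).add_posSemidef (hY.posSemidef.smul hb)

/-- Ando's convexity theorem for `Tr[K* A^p K Z^{1-p}]`. -/
theorem ando_convexity {A A' : Matrix ι ι ℂ} {Z Z' : Matrix κ κ ℂ} (hA : A.PosSemidef)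
    (hA' : A'.PosSemidef) (hZ : Z.PosDef) (hZ' : Z'.PosDef) {a b p : ℝ} (ha : 0 ≤ a)
    (hb : 0 ≤ b) (hab : a + b = 1) (hp : p ∈ Icc (1 : ℝ) 2) (K : Matrix ι κ ℂ) :
    (trace (Kᴴ * (a • A + b • A') ^ p * K * (a • Z + b • Z') ^ (1 - p))).re ≤
      a * (trace (Kᴴ * A ^ p * K * Z ^ (1 - p))).re +
        b * (trace (Kᴴ * A' ^ p * K * Z' ^ (1 - p))).re := by
  have hZm := posDef_combo hZ hZ' ha hb hab
  have hAm := posSemidef_combo hA hA' ha hb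
  have hcont {B : Matrix ι ι ℂ} {Y : Matrix κ κ ℂ} (hB : B.PosSemidef) (hY : Y.PosDef) :
      ContinuousOn (fun p : ℝ => (trace (Kᴴ * B ^ p * K * Y ^ (1 - p))).re) (Icc 1 2) := by
    simp only [re_trace_rpow_mul_rpow hB hY.posSemidef, jointSum]
    refine continuousOn_finsetSum _ fun i _ => continuousOn_finsetSum _ fun j _ =>
      continuousOn_const.mul (ContinuousOn.mul ?_ ?_)
    · intro s hs
      exact (Real.continuousAt_const_rpow' (by linarith [hs.1])).continuousWithinAt
    · exact (Continuous.rpow continuous_const (by fun_prop)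
        fun _ => Or.inl (hY.eigenvalues_pos j).ne').continuousOn
  -- The endpoints p = 1 and p = 2 are reached by continuity in p.
  rw [← closure_Ioo (by norm_num : (1 : ℝ) ≠ 2)] at hp hcont
  exact le_on_closure (s := Ioo (1 : ℝ) 2)
    (fun s hs => ando_convexity_of_mem_Ioo hA hA' hZ hZ' ha hb hZm hs K) (hcont hAm hZm)
    ((continuousOn_const.mul (hcont hA hZ)).add (continuousOn_const.mul (hcont hA' hZ'))) hp

end

/-! ### Convexity and concavity of Tr (∑ B_k* A_k^p B_k)^{q/p} -/

section

variable {ι κ σ : Type*} [Fintype ι] [Fintype κ] [DecidableEq ι] [Fintype σ]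

lemma rpow_rpow {A : Matrix ι ι ℂ} (hA : A.PosSemidef) (r s : ℝ) (hr : 0 ≤ r) (hs : 0 ≤ s) :
    (A ^ r) ^ s = A ^ (r * s) :=
  CFC.rpow_rpow_of_exponent_nonneg A r s hr hs (nonneg_iff_posSemidef.mpr hA)

lemma rpow_rpow_of_posDef {A : Matrix ι ι ℂ} (hA : A.PosDef) (r s : ℝ) (hr : r ≠ 0) :
    (A ^ r) ^ s = A ^ (r * s) :=
  CFC.rpow_rpow A r s hr (isStrictlyPositive_iff_posDef.mpr hA)

lemma rpow_posDef {A : Matrix ι ι ℂ} (hA : A.PosDef) (r : ℝ) : (A ^ r).PosDef :=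
  (rpow_posSemidef A r).posDef_iff_isUnit.mpr
    (hA.isUnit.cfcRpow r (nonneg_iff_posSemidef.mpr hA.posSemidef))

/-- The trace of a product of positive semidefinite matrices is nonnegative. -/
lemma re_trace_mul_nonneg {X Y : Matrix ι ι ℂ} (hX : X.PosSemidef) (hY : Y.PosSemidef) :
    0 ≤ (trace (X * Y)).re := by
  have := re_trace_mul_rpow hX hY 1
  rw [CFC.rpow_one Y (nonneg_iff_posSemidef.mpr hY)] at this
  rw [this]
  exact Finset.sum_nonneg fun i _ => Finset.sum_nonneg fun j _ => mul_nonneg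
    (Complex.normSq_nonneg _) (mul_nonneg (hX.eigenvalues_nonneg i)
      (Real.rpow_nonneg (hY.eigenvalues_nonneg j) _))

/-- The sum `∑ B_k* A_k^p B_k`. -/
def congrSum (p : ℝ) (B : σ → Matrix ι κ ℂ) (A : σ → Matrix ι ι ℂ) : Matrix κ κ ℂ :=
  ∑ k, (B k)ᴴ * A k ^ p * B k

lemma congrSum_posSemidef (p : ℝ) (B : σ → Matrix ι κ ℂ) (A : σ → Matrix ι ι ℂ) :
    (congrSum p B A).PosSemidef :=
  posSemidef_sum _ fun k _ => (rpow_posSemidef (A k) p).conjTranspose_mul_mul_same (B k)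

lemma re_trace_congrSum_mul (p : ℝ) (B : σ → Matrix ι κ ℂ) (A : σ → Matrix ι ι ℂ)
    (Y : Matrix κ κ ℂ) :
    (trace (congrSum p B A * Y)).re = ∑ k, (trace ((B k)ᴴ * A k ^ p * B k * Y)).re := by
  simp [congrSum, Finset.sum_mul, trace_sum]

variable [DecidableEq κ]

lemma re_trace_congrSum_convex {p : ℝ} (hp : p ∈ Set.Icc (1 : ℝ) 2) (B : σ → Matrix ι κ ℂ)
    {A A' : σ → Matrix ι ι ℂ} (hA : ∀ k, (A k).PosSemidef) (hA' : ∀ k, (A' k).PosSemidef)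
    {Z Z' : Matrix κ κ ℂ} (hZ : Z.PosDef) (hZ' : Z'.PosDef) {a b : ℝ} (ha : 0 ≤ a) (hb : 0 ≤ b)
    (hab : a + b = 1) :
    (trace (congrSum p B (a • A + b • A') * (a • Z + b • Z') ^ (1 - p))).re ≤
      a * (trace (congrSum p B A * Z ^ (1 - p))).re +
        b * (trace (congrSum p B A' * Z' ^ (1 - p))).re := by
  simp only [re_trace_congrSum_mul, Finset.mul_sum]
  rw [← Finset.sum_add_distrib]
  exact Finset.sum_le_sum fun k _ => ando_convexity (hA k) (hA' k) hZ hZ' ha hb hab hp (B k)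

lemma re_trace_congrSum_concave {p : ℝ} (hp : p ∈ Set.Ioo (0 : ℝ) 1) (B : σ → Matrix ι κ ℂ)
    {A A' : σ → Matrix ι ι ℂ} (hA : ∀ k, (A k).PosSemidef) (hA' : ∀ k, (A' k).PosSemidef)
    {Z Z' : Matrix κ κ ℂ} (hZ : Z.PosSemidef) (hZ' : Z'.PosSemidef) {a b : ℝ} (ha : 0 ≤ a)
    (hb : 0 ≤ b) :
    a * (trace (congrSum p B A * Z ^ (1 - p))).re +
        b * (trace (congrSum p B A' * Z' ^ (1 - p))).re ≤
      (trace (congrSum p B (a • A + b • A') * (a • Z + b • Z') ^ (1 - p))).re := by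
  simp only [re_trace_congrSum_mul, Finset.mul_sum]
  rw [← Finset.sum_add_distrib]
  exact Finset.sum_le_sum fun k _ => lieb_concavity (hA k) (hA' k) hZ hZ' ha hb hp (B k)

/-- Ando's theorem with Z = Z' = 1, after absorbing Y^(1/2) into each B_k. -/
lemma re_trace_congrSum_mul_convex {p : ℝ} (hp : p ∈ Set.Icc (1 : ℝ) 2) (B : σ → Matrix ι κ ℂ)
    {A A' : σ → Matrix ι ι ℂ} (hA : ∀ k, (A k).PosSemidef) (hA' : ∀ k, (A' k).PosSemidef)
    {Y : Matrix κ κ ℂ} (hY : Y.PosSemidef) {a b : ℝ} (ha : 0 ≤ a) (hb : 0 ≤ b)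
    (hab : a + b = 1) :
    (trace (congrSum p B (a • A + b • A') * Y)).re ≤
      a * (trace (congrSum p B A * Y)).re + b * (trace (congrSum p B A' * Y)).re := by
  have hS : (Y ^ (1 / 2 : ℝ))ᴴ = Y ^ (1 / 2 : ℝ) := (rpow_posSemidef Y _).isHermitian
  have hSS : Y ^ (1 / 2 : ℝ) * Y ^ (1 / 2 : ℝ) = Y := by
    rw [rpow_mul_rpow hY (by norm_num) (by norm_num), add_halves,
      CFC.rpow_one Y (nonneg_iff_posSemidef.mpr hY)]
  have key (C : σ → Matrix ι ι ℂ) : (trace (congrSum p B C * Y)).re =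
      (trace (congrSum p (fun k => B k * Y ^ (1 / 2 : ℝ)) C * (1 : Matrix κ κ ℂ) ^ (1 - p))).re := by
    rw [re_trace_congrSum_mul, re_trace_congrSum_mul]
    refine Finset.sum_congr rfl fun k _ => ?_
    rw [CFC.one_rpow, Matrix.mul_one, conjTranspose_mul, hS]
    nth_rewrite 1 [← hSS]
    congr 1
    rw [← Matrix.mul_assoc, Matrix.trace_mul_comm]
    simp only [Matrix.mul_assoc]
  rw [key, key, key]
  have := re_trace_congrSum_convex hp (fun k => B k * Y ^ (1 / 2 : ℝ)) hA hA' PosDef.one PosDef.one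
    ha hb hab
  rwa [← add_smul, hab, one_smul] at this

lemma re_trace_congrSum_concave_one {p : ℝ} (hp : 0 < p) (hp1 : p ≤ 1) (B : σ → Matrix ι κ ℂ)
    {A A' : σ → Matrix ι ι ℂ} (hA : ∀ k, (A k).PosSemidef) (hA' : ∀ k, (A' k).PosSemidef)
    {a b : ℝ} (ha : 0 ≤ a) (hb : 0 ≤ b) (hab : a + b = 1) :
    a * (trace (congrSum p B A)).re + b * (trace (congrSum p B A')).re ≤
      (trace (congrSum p B (a • A + b • A'))).re := by
  rcases hp1.eq_or_lt with rfl | hp1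
  · have h {C : Matrix ι ι ℂ} (hC : C.PosSemidef) : C ^ (1 : ℝ) = C :=
      CFC.rpow_one C (nonneg_iff_posSemidef.mpr hC)
    refine le_of_eq ?_
    simp only [congrSum, Pi.add_apply, Pi.smul_apply, h (hA _), h (hA' _),
      h (posSemidef_combo (hA _) (hA' _) ha hb), trace_sum, Complex.re_sum, Finset.mul_sum,
      ← Finset.sum_add_distrib]
    exact Finset.sum_congr rfl fun k _ => by simp [Matrix.mul_add, Matrix.add_mul, trace_add]
  · have := re_trace_congrSum_concave ⟨hp, hp1⟩ B hA hA' PosSemidef.one PosSemidef.one ha hb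
    rw [← add_smul, hab, one_smul] at this
    simpa [CFC.one_rpow] using this

/-- Convexity of `Tr (∑ B_k* A_k^p B_k)^{q/p}` for `1 ≤ p ≤ 2` and `q ≥ p`. -/
lemma trPow_congrSum_convex_of_le {p q : ℝ} (hp : p ∈ Set.Icc (1 : ℝ) 2) (hpq : p ≤ q)
    (B : σ → Matrix ι κ ℂ) {A A' : σ → Matrix ι ι ℂ} (hA : ∀ k, (A k).PosSemidef)
    (hA' : ∀ k, (A' k).PosSemidef) {a b : ℝ} (ha : 0 ≤ a) (hb : 0 ≤ b) (hab : a + b = 1) :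
    trPow (q / p) (congrSum p B (a • A + b • A')) ≤
      a * trPow (q / p) (congrSum p B A) + b * trPow (q / p) (congrSum p B A') := by
  have hp0 : 0 < p := by linarith [hp.1]
  have hr : 1 ≤ q / p := (one_le_div hp0).mpr hpq
  set r := q / p
  set M := congrSum p B (a • A + b • A')
  have hM : M.PosSemidef := congrSum_posSemidef _ _ _
  -- Klein's inequality based at M, the value at the combination, is an equality there and a lower
  -- bound at the endpoints; the weight M^(r-1) stays fixed.
  have h1 := klein_of_one_le (congrSum_posSemidef p B A) hM hr
  have h2 := klein_of_one_le (congrSum_posSemidef p B A') hM hr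
  have h3 := re_trace_congrSum_mul_convex hp B hA hA' (rpow_posSemidef M (r - 1)) ha hb hab
  change (trace (M * M ^ (r - 1))).re ≤ _ at h3
  rw [re_trace_mul_rpow_sub_one hM hr] at h3
  have h4 := mul_le_mul_of_nonneg_left h3 (by linarith : (0 : ℝ) ≤ r)
  have h5 := mul_le_mul_of_nonneg_left h1 ha
  have h6 := mul_le_mul_of_nonneg_left h2 hb
  obtain rfl : b = 1 - a := by linarith
  linarith

/-- Subadditivity of x^r for r ≤ 1, applied to the eigenvalues. It bounds the cost of making a
singular matrix invertible. -/
lemma trPow_add_smul_one_le {X : Matrix ι ι ℂ} (hX : X.PosSemidef) {ε r : ℝ} (hε : 0 < ε)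
    (hr0 : 0 < r) (hr : r ≤ 1) :
    trPow r (X + ε • (1 : Matrix ι ι ℂ)) ≤ trPow r X + Fintype.card ι * ε ^ r := by
  have hY : (X + ε • (1 : Matrix ι ι ℂ)).PosSemidef := hX.add (PosSemidef.one.smul hε.le)
  have e : X + ε • (1 : Matrix ι ι ℂ) = cfc (fun x : ℝ => x + ε) X := by
    rw [cfc_add_const ε (fun x : ℝ => x) X, cfc_id_of_isHermitian hX.isHermitian,
      Algebra.algebraMap_eq_smul_one]
  have e2 : (X + ε • (1 : Matrix ι ι ℂ)) ^ r = cfc (fun x : ℝ => (x + ε) ^ r) X := by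
    rw [rpow_eq_cfc hY, e, ← cfc_comp' (fun x : ℝ => x ^ r) (fun x : ℝ => x + ε) X
      ((finite_real_spectrum.image _).continuousOn _)]
  have tr (f : ℝ → ℝ) : (trace (cfc f X)).re = ∑ i, f (hX.isHermitian.eigenvalues i) := by
    rw [cfc_eq_conj hX.isHermitian, Matrix.trace_mul_comm, ← Matrix.mul_assoc]
    have hU : (hX.isHermitian.eigenvectorUnitary : Matrix ι ι ℂ)ᴴ *
      hX.isHermitian.eigenvectorUnitary = 1 := Unitary.coe_star_mul_self _
    rw [hU, Matrix.one_mul]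
    simp [trace]
  rw [trPow, trPow, e2, rpow_eq_cfc hX, tr, tr]
  calc _ ≤ ∑ i, (hX.isHermitian.eigenvalues i ^ r + ε ^ r) :=
        Finset.sum_le_sum fun i _ =>
          Real.rpow_add_le_add_rpow (hX.eigenvalues_nonneg i) hε.le hr0.le hr
    _ = _ := by simp [Finset.sum_add_distrib]

/-- Convexity of `Tr (∑ B_k* A_k^p B_k)^{q/p}` for `1 ≤ q < p ≤ 2`. -/
lemma trPow_congrSum_convex_of_lt {p q : ℝ} (hp : p ≤ 2) (hq : 1 ≤ q) (hpq : q < p)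
    (B : σ → Matrix ι κ ℂ) {A A' : σ → Matrix ι ι ℂ} (hA : ∀ k, (A k).PosSemidef)
    (hA' : ∀ k, (A' k).PosSemidef) {a b : ℝ} (ha : 0 ≤ a) (hb : 0 ≤ b) (hab : a + b = 1) :
    trPow (q / p) (congrSum p B (a • A + b • A')) ≤
      a * trPow (q / p) (congrSum p B A) + b * trPow (q / p) (congrSum p B A') := by
  have hp0 : 0 < p := by linarith
  have hp1 : 0 < p - 1 := by linarith
  have hpq' : 0 < p - q := by linarith
  have hr0 : 0 < q / p := by positivity
  have hr1 : q / p < 1 := (div_lt_one hp0).mpr hpq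
  set r := q / p with hr
  -- `W = Y ^ w` with `Y ^ (r - 1) = W ^ (1 - p)` and `Y ^ r = W ^ u`
  set w := (1 - r) / (p - 1) with hw
  have hw0 : 0 < w := div_pos (by linarith) hp1
  set u := r / w with hu
  have hwp : w * (1 - p) = r - 1 := by rw [hw]; field_simp; ring
  have hwu : w * u = r := by rw [hu]; field_simp
  -- Here q ≥ 1 enters: u = q(p-1)/(p-q).
  have hu1 : 1 ≤ u := by
    rw [hu, one_le_div hw0, hw, div_le_iff₀ hp1, hr, ← sub_nonneg]
    have : q / p * (p - 1) - (1 - q / p) = q - 1 := by field_simp; ring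
    rw [this]; linarith
  set X := congrSum p B A
  set X' := congrSum p B A'
  have hX : X.PosSemidef := congrSum_posSemidef _ _ _
  have hX' : X'.PosSemidef := congrSum_posSemidef _ _ _
  have hM : (congrSum p B (a • A + b • A')).PosSemidef := congrSum_posSemidef _ _ _
  -- A nearly optimal W in the infimum. The optimum would be at Y = T, but r - 1 < 0 and T may be
  -- singular, hence Y = T + ε.
  have bound {T : Matrix κ κ ℂ} (hT : T.PosSemidef) {ε : ℝ} (hε : 0 < ε) :
      ∃ W : Matrix κ κ ℂ, W.PosDef ∧ r * (trace (T * W ^ (1 - p))).re + (1 - r) * trPow u W ≤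
        trPow r T + Fintype.card κ * ε ^ r := by
    have hY : (T + ε • (1 : Matrix κ κ ℂ)).PosDef := (PosDef.one.smul hε).posSemidef_add hT
    set Y := T + ε • (1 : Matrix κ κ ℂ) with hYdef
    have h1 : (Y ^ w) ^ (1 - p) = Y ^ (r - 1) := by rw [rpow_rpow_of_posDef hY _ _ hw0.ne', hwp]
    have h2 : (Y ^ w) ^ u = Y ^ r := by rw [rpow_rpow_of_posDef hY _ _ hw0.ne', hwu]
    refine ⟨Y ^ w, rpow_posDef hY w, ?_⟩
    rw [h1, trPow, h2]
    have h3 : (trace (T * Y ^ (r - 1))).re ≤ (trace (Y ^ r)).re := by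
      have h4 : Y ^ r = Y * Y ^ (r - 1) := by
        have := CFC.rpow_add (a := Y) (x := 1) (y := r - 1) hY.isUnit
        rwa [CFC.rpow_one Y (nonneg_iff_posSemidef.mpr hY.posSemidef), add_sub_cancel] at this
      rw [h4]
      nth_rewrite 2 [hYdef]
      rw [Matrix.add_mul, trace_add, Complex.add_re]
      have := re_trace_mul_nonneg (PosSemidef.one.smul hε.le) (rpow_posSemidef Y (r - 1))
      linarith
    have h5 := trPow_add_smul_one_le hT hε hr0 hr1.le
    rw [← hYdef, trPow] at h5
    nlinarith [mul_le_mul_of_nonneg_left h3 hr0.le]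
  have main (ε : ℝ) (hε : 0 < ε) : trPow r (congrSum p B (a • A + b • A')) ≤
      a * trPow r X + b * trPow r X' + Fintype.card κ * ε ^ r := by
    obtain ⟨W, hW, h1⟩ := bound hX hε
    obtain ⟨W', hW', h2⟩ := bound hX' hε
    have hWm := posDef_combo hW hW' ha hb hab
    have h3 := re_trace_congrSum_convex ⟨by linarith, hp⟩ B hA hA' hW hW' ha hb hab
    have h4 := trPow_convex hW.posSemidef hW'.posSemidef ha hb hab hu1
    set Wm := a • W + b • W'
    have hYp := rpow_posDef hWm w⁻¹
    -- The convex combination of the two nearly optimal W is a competitor for the combination of the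
    -- arguments.
    have h5 := klein_of_le_one hM hYp hr0.le hr1.le
    have e1 : (Wm ^ w⁻¹) ^ (r - 1) = Wm ^ (1 - p) := by
      rw [rpow_rpow_of_posDef hWm _ _ (inv_ne_zero hw0.ne'), ← hwp]; congr 1; field_simp
    have e2 : (Wm ^ w⁻¹) ^ r = Wm ^ u := by
      rw [rpow_rpow_of_posDef hWm _ _ (inv_ne_zero hw0.ne'), ← hwu]; congr 1; field_simp
    rw [e1, trPow.eq_1 r (Wm ^ w⁻¹), e2, ← trPow.eq_1] at h5
    have h6 := mul_le_mul_of_nonneg_left h1 ha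
    have h7 := mul_le_mul_of_nonneg_left h2 hb
    have h8 := mul_le_mul_of_nonneg_left h3 hr0.le
    have h9 := mul_le_mul_of_nonneg_left h4 (by linarith : 0 ≤ 1 - r)
    have h10 : a * (Fintype.card κ * ε ^ r) + b * (Fintype.card κ * ε ^ r) =
      Fintype.card κ * ε ^ r := by rw [← add_mul, hab, one_mul]
    linarith
  have hlim : Filter.Tendsto (fun ε : ℝ => a * trPow r X + b * trPow r X' +
      Fintype.card κ * ε ^ r) (nhdsWithin 0 (Set.Ioi 0)) (nhds (a * trPow r X + b * trPow r X')) := by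
    have : Filter.Tendsto (fun ε : ℝ => ε ^ r) (nhdsWithin 0 (Set.Ioi 0)) (nhds 0) := by
      have := (Real.continuousAt_rpow_const 0 r (Or.inr hr0.le)).tendsto
      rw [Real.zero_rpow hr0.ne'] at this
      exact this.mono_left nhdsWithin_le_nhds
    simpa using (this.const_mul (Fintype.card κ : ℝ)).const_add (a * trPow r X + b * trPow r X')
  exact ge_of_tendsto hlim (Filter.eventually_of_mem self_mem_nhdsWithin main)

/-- Convexity of `Tr (∑ B_k* A_k^p B_k)^{q/p}` for `1 ≤ p ≤ 2` and `q ≥ 1`. -/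
theorem trPow_congrSum_convex {p q : ℝ} (hp1 : 1 ≤ p) (hp : p ≤ 2) (hq : 1 ≤ q)
    (B : σ → Matrix ι κ ℂ) {A A' : σ → Matrix ι ι ℂ} (hA : ∀ k, (A k).PosSemidef)
    (hA' : ∀ k, (A' k).PosSemidef) {a b : ℝ} (ha : 0 ≤ a) (hb : 0 ≤ b) (hab : a + b = 1) :
    trPow (q / p) (congrSum p B (a • A + b • A')) ≤
      a * trPow (q / p) (congrSum p B A) + b * trPow (q / p) (congrSum p B A') := by
  rcases le_or_gt p q with h | h
  · exact trPow_congrSum_convex_of_le ⟨hp1, hp⟩ h B hA hA' ha hb hab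
  · exact trPow_congrSum_convex_of_lt hp hq h B hA hA' ha hb hab

/-- Concavity of `Tr (∑ B_k* A_k^p B_k)^{q/p}` for `0 < p ≤ q ≤ 1`. -/
theorem trPow_congrSum_concave {p q : ℝ} (hp0 : 0 < p) (hpq : p ≤ q) (hq : q ≤ 1)
    (B : σ → Matrix ι κ ℂ) {A A' : σ → Matrix ι ι ℂ} (hA : ∀ k, (A k).PosSemidef)
    (hA' : ∀ k, (A' k).PosSemidef) {a b : ℝ} (ha : 0 ≤ a) (hb : 0 ≤ b) (hab : a + b = 1) :
    a * trPow (q / p) (congrSum p B A) + b * trPow (q / p) (congrSum p B A') ≤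
      trPow (q / p) (congrSum p B (a • A + b • A')) := by
  rcases hpq.eq_or_lt with rfl | hpq
  · have h (C : σ → Matrix ι ι ℂ) : trPow (p / p) (congrSum p B C) = (trace (congrSum p B C)).re := by
      rw [div_self hp0.ne', trPow,
        CFC.rpow_one _ (nonneg_iff_posSemidef.mpr (congrSum_posSemidef p B C))]
    rw [h, h, h]
    exact re_trace_congrSum_concave_one hp0 hq B hA hA' ha hb hab
  have hp1 : 0 < 1 - p := by linarith
  have hr1 : 1 < q / p := (one_lt_div hp0).mpr hpq
  set r := q / p with hr
  -- `Z = Y ^ w` with `Y ^ (r - 1) = Z ^ (1 - p)` and `Y ^ r = Z ^ u`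
  set w := (r - 1) / (1 - p) with hw
  have hw0 : 0 < w := div_pos (by linarith) hp1
  set u := r / w with hu
  have hwp : w * (1 - p) = r - 1 := by rw [hw]; field_simp
  have hwu : w * u = r := by rw [hu]; field_simp
  -- Here q ≤ 1 enters: u = q(1-p)/(q-p).
  have hu1 : 1 ≤ u := by
    rw [hu, one_le_div hw0, hw, div_le_iff₀ hp1, hr, ← sub_nonneg]
    have : q / p * (1 - p) - (q / p - 1) = 1 - q := by field_simp; ring
    rw [this]; linarith
  set X := congrSum p B A
  set X' := congrSum p B A'
  have hX : X.PosSemidef := congrSum_posSemidef _ _ _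
  have hX' : X'.PosSemidef := congrSum_posSemidef _ _ _
  have hM : (congrSum p B (a • A + b • A')).PosSemidef := congrSum_posSemidef _ _ _
  -- The maximum is attained at Y = T. All exponents are nonnegative, so no regularisation is
  -- needed.
  have eq {T : Matrix κ κ ℂ} (hT : T.PosSemidef) :
      r * (trace (T * (T ^ w) ^ (1 - p))).re - (r - 1) * trPow u (T ^ w) = trPow r T := by
    rw [rpow_rpow hT _ _ hw0.le hp1.le, hwp, re_trace_mul_rpow_sub_one hT hr1.le, trPow.eq_1 u,
      rpow_rpow hT _ _ hw0.le (by linarith), hwu, ← trPow.eq_1]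
    ring
  have hW := rpow_posSemidef X w
  have hW' := rpow_posSemidef X' w
  have hWm := posSemidef_combo hW hW' ha hb
  have h1 := eq hX
  have h2 := eq hX'
  have h3 := re_trace_congrSum_concave ⟨hp0, by linarith⟩ B hA hA' hW hW' ha hb
  have h4 := trPow_convex hW hW' ha hb hab hu1
  set Wm := a • X ^ w + b • X' ^ w
  -- The combination of the two maximisers is a competitor, now giving a lower bound.
  have h5 := klein_of_one_le hM (rpow_posSemidef Wm w⁻¹) hr1.le
  have e1 : (Wm ^ w⁻¹) ^ (r - 1) = Wm ^ (1 - p) := by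
    rw [rpow_rpow hWm _ _ (inv_nonneg.mpr hw0.le) (by linarith), ← hwp]; congr 1; field_simp
  have e2 : (Wm ^ w⁻¹) ^ r = Wm ^ u := by
    rw [rpow_rpow hWm _ _ (inv_nonneg.mpr hw0.le) (by linarith), ← hwu]; congr 1; field_simp
  rw [e1, trPow.eq_1 r (Wm ^ w⁻¹), e2, ← trPow.eq_1] at h5
  rw [← h1, ← h2]
  have h8 := mul_le_mul_of_nonneg_left h3 (by linarith : 0 ≤ r)
  have h9 := mul_le_mul_of_nonneg_left h4 (by linarith : 0 ≤ r - 1)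
  linarith

end

/-! ### Roots of homogeneous convex and concave functions -/

section

section Homogeneous

variable {E : Type*} [AddCommGroup E] [Module ℝ E] {S : Set E} {f : E → ℝ} {q : ℝ}

/-- A nonnegative convex function that is homogeneous of degree `q > 0` has a convex `q`-th root. -/
lemma convexOn_rpow_inv_of_homogeneous (hcone : ∀ x ∈ S, ∀ t : ℝ, 0 ≤ t → t • x ∈ S)
    (hf : ConvexOn ℝ S f) (hf0 : ∀ x ∈ S, 0 ≤ f x)
    (hhom : ∀ x ∈ S, ∀ t : ℝ, 0 ≤ t → f (t • x) = t ^ q * f x) (hq : 0 < q) :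
    ConvexOn ℝ S fun x => f x ^ (1 / q) := by
  refine ⟨hf.1, fun x hx y hy a b ha hb hab => ?_⟩
  have root {z : E} (hz : z ∈ S) {c : ℝ} (hc : f z ^ (1 / q) < c) (hc0 : 0 < c) :
      f (c⁻¹ • z) ≤ 1 := by
    rw [hhom z hz _ (inv_nonneg.mpr hc0.le), Real.inv_rpow hc0.le]
    have h1 : f z ≤ c ^ q := by
      have := Real.rpow_le_rpow (Real.rpow_nonneg (hf0 z hz) _) hc.le hq.le
      rwa [← Real.rpow_mul (hf0 z hz), one_div_mul_cancel hq.ne', Real.rpow_one] at this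
    rw [inv_mul_le_iff₀ (Real.rpow_pos_of_pos hc0 q), mul_one]
    exact h1
  refine le_of_forall_pos_le_add fun η hη => ?_
  -- The added η permits division even where f vanishes. Then x/α and y/β lie in the convex sublevel
  -- set f ≤ 1, and the given point is s times a convex combination of them.
  set α := f x ^ (1 / q) + η with hα
  set β := f y ^ (1 / q) + η with hβ
  have hx0 := Real.rpow_nonneg (hf0 x hx) (1 / q)
  have hy0 := Real.rpow_nonneg (hf0 y hy) (1 / q)
  have hα0 : 0 < α := by linarith
  have hβ0 : 0 < β := by linarith
  set s := a * α + b * β with hs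
  have hs0 : 0 < s := by
    rcases ha.eq_or_lt with rfl | ha
    · obtain rfl : b = 1 := by linarith
      simpa [hs] using hβ0
    · positivity
  have hx1 := root hx (c := α) (by linarith) hα0
  have hy1 := root hy (c := β) (by linarith) hβ0
  have hxS := hcone x hx α⁻¹ (inv_nonneg.mpr hα0.le)
  have hyS := hcone y hy β⁻¹ (inv_nonneg.mpr hβ0.le)
  have hc1 : 0 ≤ a * α / s := by positivity
  have hc2 : 0 ≤ b * β / s := by positivity
  have hc3 : a * α / s + b * β / s = 1 := by rw [← add_div, ← hs, div_self hs0.ne']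
  have h := hf.2 hxS hyS hc1 hc2 hc3
  have hmem := hf.1 hxS hyS hc1 hc2 hc3
  have hcomb : a • x + b • y = s • ((a * α / s) • α⁻¹ • x + (b * β / s) • β⁻¹ • y) := by
    simp only [smul_add, smul_smul]
    congr 2 <;> field_simp
  have hle : f (a • x + b • y) ≤ s ^ q := by
    rw [hcomb, hhom _ hmem s hs0.le]
    refine mul_le_of_le_one_right (Real.rpow_nonneg hs0.le q) (h.trans ?_)
    simp only [smul_eq_mul]
    nlinarith
  have h2 := Real.rpow_le_rpow (hf0 _ (hf.1 hx hy ha hb hab)) hle (by positivity : 0 ≤ 1 / q)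
  rw [← Real.rpow_mul hs0.le, mul_one_div_cancel hq.ne', Real.rpow_one] at h2
  refine h2.trans (le_of_eq ?_)
  simp only [hs, hα, hβ, smul_eq_mul]
  linear_combination η * hab

/-- A nonnegative concave function that is homogeneous of degree `q > 0` has a concave `q`-th
root. -/
lemma concaveOn_rpow_inv_of_homogeneous (hcone : ∀ x ∈ S, ∀ t : ℝ, 0 ≤ t → t • x ∈ S)
    (hf : ConcaveOn ℝ S f) (hf0 : ∀ x ∈ S, 0 ≤ f x)
    (hhom : ∀ x ∈ S, ∀ t : ℝ, 0 ≤ t → f (t • x) = t ^ q * f x) (hq : 0 < q) :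
    ConcaveOn ℝ S fun x => f x ^ (1 / q) := by
  have root {z : E} (hz : z ∈ S) : f z = (f z ^ (1 / q)) ^ q := by
    rw [← Real.rpow_mul (hf0 z hz), one_div_mul_cancel hq.ne', Real.rpow_one]
  -- adding an element of the cone does not decrease `f`
  have mono {x y : E} (hx : x ∈ S) (hy : y ∈ S) : f y ≤ f (x + y) := by
    -- x + y is the combination of x/(1-θ) and y/θ with weights 1-θ and θ; drop the first term and
    -- let θ tend to 1. This replaces normalisation when f vanishes at an endpoint.
    have step (θ : ℝ) (hθ : θ ∈ Set.Ioo (0 : ℝ) 1) : θ * (θ⁻¹ ^ q * f y) ≤ f (x + y) := by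
      have h1 : 0 < 1 - θ := sub_pos.mpr hθ.2
      have h := hf.2 (hcone x hx (1 - θ)⁻¹ (inv_nonneg.mpr h1.le))
        (hcone y hy θ⁻¹ (inv_nonneg.mpr hθ.1.le)) h1.le hθ.1.le (by ring)
      rw [smul_smul, smul_smul, mul_inv_cancel₀ h1.ne', mul_inv_cancel₀ hθ.1.ne', one_smul,
        one_smul, hhom y hy _ (inv_nonneg.mpr hθ.1.le), smul_eq_mul, smul_eq_mul] at h
      have := mul_nonneg h1.le (hf0 _ (hcone x hx (1 - θ)⁻¹ (inv_nonneg.mpr h1.le)))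
      linarith
    have hlim : Filter.Tendsto (fun θ : ℝ => θ * (θ⁻¹ ^ q * f y)) (nhdsWithin 1 (Set.Iio 1))
        (nhds (f y)) := by
      have : ContinuousAt (fun θ : ℝ => θ * (θ⁻¹ ^ q * f y)) 1 :=
        continuousAt_id.mul (((continuousAt_inv₀ one_ne_zero).rpow_const
          (Or.inr hq.le)).mul continuousAt_const)
      have := this.tendsto
      simp only [inv_one, Real.one_rpow, one_mul] at this
      exact this.mono_left nhdsWithin_le_nhds
    exact le_of_tendsto hlim (Filter.eventually_of_mem (Ioo_mem_nhdsLT zero_lt_one) step)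
  have zero_case {x y : E} (hx : x ∈ S) (hy : y ∈ S) {b : ℝ} (hb : 0 ≤ b) :
      b * f y ^ (1 / q) ≤ f (x + b • y) ^ (1 / q) := by
    have h := Real.rpow_le_rpow (hf0 _ (hcone y hy b hb)) (mono hx (hcone y hy b hb))
      (by positivity : 0 ≤ 1 / q)
    rwa [hhom y hy b hb, Real.mul_rpow (Real.rpow_nonneg hb q) (hf0 y hy), ← Real.rpow_mul hb,
      mul_one_div_cancel hq.ne', Real.rpow_one] at h
  refine ⟨hf.1, fun x hx y hy a b ha hb hab => ?_⟩
  simp only [smul_eq_mul]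
  rcases (Real.rpow_nonneg (hf0 x hx) (1 / q)).eq_or_lt with hα0 | hα0
  · rw [← hα0, mul_zero, zero_add]
    exact zero_case (hcone x hx a ha) hy hb
  rcases (Real.rpow_nonneg (hf0 y hy) (1 / q)).eq_or_lt with hβ0 | hβ0
  · rw [← hβ0, mul_zero, add_zero, add_comm (a • x)]
    exact zero_case (hcone y hy b hb) hx ha
  set α := f x ^ (1 / q) with hα
  set β := f y ^ (1 / q) with hβ
  set s := a * α + b * β with hs
  have hs0 : 0 < s := by
    rcases ha.eq_or_lt with rfl | ha
    · obtain rfl : b = 1 := by linarith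
      simpa [hs] using hβ0
    · positivity
  have normalize {z : E} (hz : z ∈ S) (h0 : 0 < f z ^ (1 / q)) :
      f ((f z ^ (1 / q))⁻¹ • z) = 1 := by
    rw [hhom z hz _ (inv_nonneg.mpr h0.le), Real.inv_rpow h0.le, ← root hz]
    refine inv_mul_cancel₀ fun h => ?_
    rw [h, Real.zero_rpow (one_div_ne_zero hq.ne')] at h0
    exact lt_irrefl _ h0
  have hxS := hcone x hx α⁻¹ (inv_nonneg.mpr hα0.le)
  have hyS := hcone y hy β⁻¹ (inv_nonneg.mpr hβ0.le)
  have hc1 : 0 ≤ a * α / s := by positivity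
  have hc2 : 0 ≤ b * β / s := by positivity
  have hc3 : a * α / s + b * β / s = 1 := by rw [← add_div, ← hs, div_self hs0.ne']
  have h := hf.2 hxS hyS hc1 hc2 hc3
  have hmem := hf.1 hxS hyS hc1 hc2 hc3
  have hcomb : a • x + b • y = s • ((a * α / s) • α⁻¹ • x + (b * β / s) • β⁻¹ • y) := by
    simp only [smul_add, smul_smul]
    congr 2 <;> field_simp
  have hle : s ^ q ≤ f (a • x + b • y) := by
    rw [hcomb, hhom _ hmem s hs0.le]
    refine le_mul_of_one_le_right (Real.rpow_nonneg hs0.le q) (le_trans ?_ h)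
    rw [normalize hx hα0, normalize hy hβ0, smul_eq_mul, smul_eq_mul, mul_one, mul_one, hc3]
  have h2 := Real.rpow_le_rpow (Real.rpow_nonneg hs0.le q) hle (by positivity : 0 ≤ 1 / q)
  rwa [← Real.rpow_mul hs0.le, mul_one_div_cancel hq.ne', Real.rpow_one] at h2

end Homogeneous

/-! ### Transfer to Υ, Ψ and Φ: parts (1) and (2) -/

variable {ι κ σ : Type*} [Fintype ι] [DecidableEq ι]

lemma smul_rpow {A : Matrix ι ι ℂ} (hA : A.PosSemidef) {t : ℝ} (ht : 0 ≤ t) (r : ℝ) :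
    (t • A) ^ r = (t ^ r) • A ^ r := by
  have e : t • A = cfc (fun x : ℝ => t * x) A := by
    rw [cfc_const_mul t (fun x : ℝ => x) A, cfc_id_of_isHermitian hA.isHermitian]
  rw [rpow_eq_cfc (hA.smul ht), rpow_eq_cfc hA, e,
    ← cfc_comp' (fun x : ℝ => x ^ r) (fun x : ℝ => t * x) A
      ((finite_real_spectrum.image _).continuousOn _),
    ← cfc_const_mul (t ^ r) (fun x : ℝ => x ^ r) A (finite_real_spectrum.continuousOn _)]
  refine cfc_congr fun x hx => ?_
  rw [hA.isHermitian.spectrum_real_eq_range_eigenvalues] at hx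
  obtain ⟨i, rfl⟩ := hx
  exact Real.mul_rpow ht (hA.eigenvalues_nonneg i)

lemma schatten_rpow {X : Matrix ι ι ℂ} (hX : X.PosSemidef) {p q : ℝ} (hp : 0 < p) (hq : 0 < q) :
    schatten q (X ^ (1 / p)) = trPow (q / p) X ^ (1 / q) := by
  have hp' : 0 ≤ 1 / p := by positivity
  rw [schatten, (rpow_posSemidef X (1 / p)).isHermitian.eq, rpow_mul_rpow hX hp' hp',
    rpow_rpow hX _ _ (by positivity) (by positivity), trPow]
  congr 4
  field_simp
  ring

lemma trPow_nonneg (r : ℝ) (X : Matrix ι ι ℂ) : 0 ≤ trPow r X :=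
  (Complex.nonneg_iff.mp (rpow_posSemidef X r).trace_nonneg).1

variable [Fintype σ]

lemma congrSum_smul [Fintype κ] {A : σ → Matrix ι ι ℂ} (hA : ∀ k, (A k).PosSemidef) {t : ℝ}
    (ht : 0 ≤ t) (p : ℝ) (B : σ → Matrix ι κ ℂ) : congrSum p B (t • A) = (t ^ p) • congrSum p B A := by
  simp only [congrSum, Finset.smul_sum, Pi.smul_apply, smul_rpow (hA _) ht, Matrix.mul_smul,
    Matrix.smul_mul]

variable [Fintype κ] [DecidableEq κ]

lemma trPow_congrSum_smul {A : σ → Matrix ι ι ℂ} (hA : ∀ k, (A k).PosSemidef) {t : ℝ}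
    (ht : 0 ≤ t) {p q : ℝ} (hp : 0 < p) (B : σ → Matrix ι κ ℂ) :
    trPow (q / p) (congrSum p B (t • A)) = t ^ q * trPow (q / p) (congrSum p B A) := by
  rw [congrSum_smul hA ht, trPow, smul_rpow (congrSum_posSemidef p B A) (Real.rpow_nonneg ht p),
    ← Real.rpow_mul ht, mul_div_cancel₀ _ hp.ne', trace_smul, Complex.smul_re, smul_eq_mul, trPow]

lemma convex_psdCone (μ : Type*) : Convex ℝ (psdCone μ) :=
  fun _ hX _ hY _ _ ha hb _ => posSemidef_combo hX hY ha hb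

lemma convexOn_trPow_congrSum {p q : ℝ} (hp1 : 1 ≤ p) (hp : p ≤ 2) (hq : 1 ≤ q)
    (B : σ → Matrix ι κ ℂ) : ConvexOn ℝ (Set.univ.pi fun _ : σ => psdCone ι)
      fun A => trPow (q / p) (congrSum p B A) :=
  ⟨convex_pi fun _ _ => convex_psdCone ι, fun _ hA _ hA' _ _ ha hb hab =>
    trPow_congrSum_convex hp1 hp hq B (fun k => hA k trivial) (fun k => hA' k trivial) ha hb hab⟩

lemma concaveOn_trPow_congrSum {p q : ℝ} (hp : 0 < p) (hpq : p ≤ q) (hq : q ≤ 1)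
    (B : σ → Matrix ι κ ℂ) : ConcaveOn ℝ (Set.univ.pi fun _ : σ => psdCone ι)
      fun A => trPow (q / p) (congrSum p B A) :=
  ⟨convex_pi fun _ _ => convex_psdCone ι, fun _ hA _ hA' _ _ ha hb hab =>
    trPow_congrSum_concave hp hpq hq B (fun k => hA k trivial) (fun k => hA' k trivial) ha hb hab⟩

lemma convexOn_schatten_congrSum {p q : ℝ} (hp1 : 1 ≤ p) (hp : p ≤ 2) (hq : 1 ≤ q)
    (B : σ → Matrix ι κ ℂ) : ConvexOn ℝ (Set.univ.pi fun _ : σ => psdCone ι)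
      fun A => schatten q (congrSum p B A ^ (1 / p)) := by
  simp only [schatten_rpow (congrSum_posSemidef p B _) (by linarith : 0 < p) (by linarith : 0 < q)]
  exact convexOn_rpow_inv_of_homogeneous
    (fun A hA t ht k _ => (hA k trivial : (A k).PosSemidef).smul ht)
    (convexOn_trPow_congrSum hp1 hp hq B) (fun A _ => trPow_nonneg _ _)
    (fun A hA t ht => trPow_congrSum_smul (fun k => hA k trivial) ht (by linarith) B) (by linarith)

lemma concaveOn_schatten_congrSum {p q : ℝ} (hp : 0 < p) (hpq : p ≤ q) (hq : q ≤ 1)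
    (B : σ → Matrix ι κ ℂ) : ConcaveOn ℝ (Set.univ.pi fun _ : σ => psdCone ι)
      fun A => schatten q (congrSum p B A ^ (1 / p)) := by
  simp only [schatten_rpow (congrSum_posSemidef p B _) hp (by linarith : 0 < q)]
  exact concaveOn_rpow_inv_of_homogeneous
    (fun A hA t ht k _ => (hA k trivial : (A k).PosSemidef).smul ht)
    (concaveOn_trPow_congrSum hp hpq hq B) (fun A _ => trPow_nonneg _ _)
    (fun A hA t ht => trPow_congrSum_smul (fun k => hA k trivial) ht hp B) (by linarith)

/-- The diagonal embedding `A ↦ (A, …, A)`. -/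
def constFamily (σ ι : Type*) : Matrix ι ι ℂ →ₗ[ℝ] (σ → Matrix ι ι ℂ) where
  toFun A _ := A
  map_add' _ _ := rfl
  map_smul' _ _ := rfl

lemma constFamily_mem {σ ι : Type*} {A : Matrix ι ι ℂ} (hA : A ∈ psdCone ι) :
    constFamily σ ι A ∈ Set.univ.pi fun _ : σ => psdCone ι := fun _ _ => hA

lemma upsilon_eq {n : ℕ} (p q : ℝ) (B : Matrix (Fin n) (Fin n) ℂ) :
    Upsilon p q B =
      (fun A => trPow (q / p) (congrSum p (fun _ : Unit => B) A)) ∘ constFamily Unit (Fin n) := by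
  ext A
  simp [Upsilon, trPow, congrSum, constFamily]

/-- The inclusion of `ℂ^ι` into `ℂ^ι ⊗ ℂ^κ` along the `k`-th basis vector. -/
def sliceIncl (ι : Type*) {κ : Type*} [DecidableEq ι] [DecidableEq κ] (k : κ) :
    Matrix (ι × κ) ι ℂ :=
  Matrix.of fun x i => if x = (i, k) then 1 else 0

lemma sliceIncl_conj (k : κ) (A : Matrix (ι × κ) (ι × κ) ℂ) :
    (sliceIncl ι k)ᴴ * A * sliceIncl ι k = Matrix.of fun i j => A (i, k) (j, k) := by
  ext i j
  simp [Matrix.mul_apply, sliceIncl, apply_ite]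

/-- The partial trace is the sum over k of the compressions by `sliceIncl`, all applied to the same
matrix. -/
lemma psi_eq {m n : ℕ} (p q : ℝ) :
    Psi p q (m := m) (n := n) =
      (fun A => schatten q (congrSum p (fun k : Fin n => sliceIncl (Fin m) k) A ^ (1 / p))) ∘
        constFamily (Fin n) (Fin m × Fin n) := by
  ext A
  simp only [Psi, Function.comp, congrSum, sliceIncl_conj]
  congr 2
  ext i j
  simp [partialTrace₂, Matrix.sum_apply, constFamily]

lemma phi_eq {m n : ℕ} (p q : ℝ) :
    Phi p q (m := m) (n := n) = fun A =>
      schatten q (congrSum p (fun _ : Fin m => (1 : Matrix (Fin n) (Fin n) ℂ)) A ^ (1 / p)) := by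
  ext A
  simp [Phi, congrSum]

theorem convexity_of_one_le_of_le_two {p q : ℝ} (hp1 : 1 ≤ p) (hp : p ≤ 2) (hq : 1 ≤ q) :
    (∀ (n : ℕ) (B : Matrix (Fin n) (Fin n) ℂ), ConvexOn ℝ (psdCone (Fin n)) (Upsilon p q B)) ∧
    (∀ m n : ℕ, ConvexOn ℝ (psdCone (Fin m × Fin n)) (Psi p q (m := m) (n := n))) ∧
    (∀ m n : ℕ, ConvexOn ℝ (Set.univ.pi fun _ : Fin m => psdCone (Fin n))
      (Phi p q (m := m) (n := n))) := by
  refine ⟨fun n B => ?_, fun m n => ?_, fun m n => ?_⟩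
  · rw [upsilon_eq]
    exact ((convexOn_trPow_congrSum hp1 hp hq _).comp_linearMap (constFamily Unit (Fin n))).subset
      (fun A hA => constFamily_mem hA) (convex_psdCone _)
  · rw [psi_eq]
    exact ((convexOn_schatten_congrSum hp1 hp hq _).comp_linearMap
      (constFamily (Fin n) (Fin m × Fin n))).subset
      (fun A hA => constFamily_mem hA) (convex_psdCone _)
  · rw [phi_eq]
    exact convexOn_schatten_congrSum hp1 hp hq _

theorem concavity_of_le_of_le_one {p q : ℝ} (hp : 0 < p) (hpq : p ≤ q) (hq : q ≤ 1) :
    (∀ (n : ℕ) (B : Matrix (Fin n) (Fin n) ℂ), ConcaveOn ℝ (psdCone (Fin n)) (Upsilon p q B)) ∧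
    (∀ m n : ℕ, ConcaveOn ℝ (psdCone (Fin m × Fin n)) (Psi p q (m := m) (n := n))) ∧
    (∀ m n : ℕ, ConcaveOn ℝ (Set.univ.pi fun _ : Fin m => psdCone (Fin n))
      (Phi p q (m := m) (n := n))) := by
  refine ⟨fun n B => ?_, fun m n => ?_, fun m n => ?_⟩
  · rw [upsilon_eq]
    exact ((concaveOn_trPow_congrSum hp hpq hq _).comp_linearMap (constFamily Unit (Fin n))).subset
      (fun A hA => constFamily_mem hA) (convex_psdCone _)
  · rw [psi_eq]
    exact ((concaveOn_schatten_congrSum hp hpq hq _).comp_linearMap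
      (constFamily (Fin n) (Fin m × Fin n))).subset
      (fun A hA => constFamily_mem hA) (convex_psdCone _)
  · rw [phi_eq]
    exact concaveOn_schatten_congrSum hp hpq hq _

end

/-! ### Failure for p > 2: diagonal entries of powers, and Υ -/

section

variable {ι κ : Type*} [Fintype ι] [DecidableEq ι] [Fintype κ] [DecidableEq κ]

/-- Powers of positive semidefinite matrices respect intertwiners. -/
lemma rpow_intertwine {A : Matrix ι ι ℂ} {B : Matrix κ κ ℂ} (hA : A.PosSemidef)
    (hB : B.PosSemidef) {W : Matrix ι κ ℂ} (h : A * W = W * B) (r : ℝ) :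
    A ^ r * W = W * B ^ r := by
  set U := (hA.isHermitian.eigenvectorUnitary : Matrix ι ι ℂ) with hU
  set V := (hB.isHermitian.eigenvectorUnitary : Matrix κ κ ℂ) with hV
  have hUU : Uᴴ * U = 1 := Unitary.coe_star_mul_self hA.isHermitian.eigenvectorUnitary
  have hUU' : U * Uᴴ = 1 := Unitary.coe_mul_star_self hA.isHermitian.eigenvectorUnitary
  have hVV : Vᴴ * V = 1 := Unitary.coe_star_mul_self hB.isHermitian.eigenvectorUnitary
  have hVV' : V * Vᴴ = 1 := Unitary.coe_mul_star_self hB.isHermitian.eigenvectorUnitary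
  -- pass to the eigenbases
  have conj (f : ℝ → ℝ) : cfc f A * W = W * cfc f B ↔
      diagonal (fun i => ((f (hA.isHermitian.eigenvalues i) : ℝ) : ℂ)) * (Uᴴ * W * V) =
        (Uᴴ * W * V) * diagonal (fun i => ((f (hB.isHermitian.eigenvalues i) : ℝ) : ℂ)) := by
    rw [cfc_eq_conj hA.isHermitian, cfc_eq_conj hB.isHermitian, ← hU, ← hV]
    generalize diagonal (fun i => ((f (hA.isHermitian.eigenvalues i) : ℝ) : ℂ)) = D
    generalize diagonal (fun i => ((f (hB.isHermitian.eigenvalues i) : ℝ) : ℂ)) = D'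
    constructor
    · intro e
      calc D * (Uᴴ * W * V) = Uᴴ * U * D * (Uᴴ * W * V) := by rw [hUU, Matrix.one_mul]
        _ = Uᴴ * (U * D * Uᴴ * W) * V := by simp only [Matrix.mul_assoc]
        _ = Uᴴ * W * V * D' * (Vᴴ * V) := by rw [e]; simp only [Matrix.mul_assoc]
        _ = _ := by rw [hVV, Matrix.mul_one]
    · intro e
      calc U * D * Uᴴ * W = U * D * Uᴴ * W * (V * Vᴴ) := by rw [hVV', Matrix.mul_one]
        _ = U * (D * (Uᴴ * W * V)) * Vᴴ := by simp only [Matrix.mul_assoc]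
        _ = (U * Uᴴ) * W * (V * D' * Vᴴ) := by rw [e]; simp only [Matrix.mul_assoc]
        _ = _ := by rw [hUU', Matrix.one_mul]
  rw [rpow_eq_cfc hA, rpow_eq_cfc hB, conj]
  have h' := (conj fun x => x).mp (by
    rwa [cfc_id_of_isHermitian hA.isHermitian, cfc_id_of_isHermitian hB.isHermitian])
  ext i j
  have hij := congrFun₂ h' i j
  rw [diagonal_mul, mul_diagonal] at hij ⊢
  -- A nonzero entry of the intertwiner forces the two eigenvalues to coincide, hence also their
  -- powers.
  by_cases h0 : (Uᴴ * W * V) i j = 0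
  · simp [h0]
  · rw [mul_comm] at hij
    have := Complex.ofReal_injective (mul_left_cancel₀ h0 hij)
    rw [this, mul_comm]

/-- An eigenvector, as a one-column matrix, intertwines A with the 1 × 1 matrix l. -/
lemma rpow_mulVec_of_eigenvector {A : Matrix ι ι ℂ} (hA : A.PosSemidef) {v : ι → ℂ} {l : ℝ}
    (hl : 0 ≤ l) (h : A *ᵥ v = (l : ℂ) • v) (r : ℝ) : A ^ r *ᵥ v = ((l ^ r : ℝ) : ℂ) • v := by
  have key := rpow_intertwine hA ((PosSemidef.one (n := Unit) (R := ℂ)).smul hl)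
    (W := replicateCol Unit v) (by
      rw [← replicateCol_mulVec, h]; ext i; simp) r
  rw [smul_rpow PosSemidef.one hl, CFC.one_rpow, ← replicateCol_mulVec] at key
  ext i
  simpa using congrFun₂ key i ()

lemma diagonal_rpow {d : ι → ℝ} (hd : ∀ i, 0 ≤ d i) (r : ℝ) :
    (diagonal fun i => (d i : ℂ)) ^ r = diagonal fun i => ((d i ^ r : ℝ) : ℂ) := by
  have hD : (diagonal fun i => (d i : ℂ)).PosSemidef :=
    PosSemidef.diagonal fun i => by simpa using hd i
  have aux (c : ι → ℂ) (j : ι) : diagonal c *ᵥ Pi.single j 1 = c j • Pi.single j 1 := by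
    ext i
    rw [mulVec_diagonal]
    rcases eq_or_ne i j with rfl | hij <;> simp [*]
  refine Matrix.ext_of_mulVec_single fun j => ?_
  rw [rpow_mulVec_of_eigenvector hD (hd j) (aux _ j), aux]

/-- The diagonal entry `⟨e_i, X^p e_i⟩`. -/
def diagPow (p : ℝ) (i : ι) (X : Matrix ι ι ℂ) : ℝ := ((X ^ p) i i).re

lemma diagPow_nonneg (p : ℝ) (i : ι) (X : Matrix ι ι ℂ) : 0 ≤ diagPow p i X :=
  (Complex.nonneg_iff.mp (rpow_posSemidef X p).diag_nonneg).1

lemma diagPow_smul (p : ℝ) (i : ι) {X : Matrix ι ι ℂ} (hX : X.PosSemidef) {t : ℝ} (ht : 0 ≤ t) :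
    diagPow p i (t • X) = t ^ p * diagPow p i X := by
  simp [diagPow, smul_rpow hX ht]

lemma rpow_diag_eq (p : ℝ) (i : ι) (X : Matrix ι ι ℂ) : (X ^ p) i i = (diagPow p i X : ℂ) :=
  ((rpow_posSemidef X p).isHermitian.coe_re_apply_self i).symm

lemma diagPow_eq_of_eigenvectors {X : Matrix ι ι ℂ} (hX : X.PosSemidef) (p : ℝ) (i : ι)
    {v w : ι → ℂ} {l m c d : ℝ} (hl : 0 ≤ l) (hm : 0 ≤ m) (hv : X *ᵥ v = (l : ℂ) • v)
    (hw : X *ᵥ w = (m : ℂ) • w) (h : Pi.single i 1 = (c : ℂ) • v + (d : ℂ) • w) :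
    diagPow p i X = c * l ^ p * (v i).re + d * m ^ p * (w i).re := by
  have e : (X ^ p) i i = (X ^ p *ᵥ Pi.single i 1) i := by rw [mulVec_single_one]; rfl
  rw [diagPow, e, h, mulVec_add, mulVec_smul, mulVec_smul, rpow_mulVec_of_eigenvector hX hl hv,
    rpow_mulVec_of_eigenvector hX hm hw]
  simp only [Pi.add_apply, Pi.smul_apply, smul_eq_mul, Complex.add_re, ← mul_assoc,
    ← Complex.ofReal_mul, Complex.re_ofReal_mul]

/-- The rank one matrix `u u*`. -/
def rankOne {ι : Type*} (u : ι → ℂ) : Matrix ι ι ℂ := vecMulVec u (star u)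

lemma rankOne_posSemidef {ι : Type*} [Fintype ι] (u : ι → ℂ) : (rankOne u).PosSemidef :=
  posSemidef_vecMulVec_self_star u

lemma rankOne_mulVec {ι : Type*} [Fintype ι] (u v : ι → ℂ) :
    rankOne u *ᵥ v = (star u ⬝ᵥ v) • u := by
  rw [rankOne, vecMulVec_mulVec, op_smul_eq_smul]

/-- The vector `a e_i + b e_j`. -/
def planeVec {ι : Type*} [DecidableEq ι] (i j : ι) (a b : ℝ) : ι → ℂ :=
  Pi.single i (a : ℂ) + Pi.single j (b : ℂ)

lemma star_planeVec_dotProduct {i j : ι} (hij : i ≠ j) (a b c d : ℝ) :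
    star (planeVec i j a b) ⬝ᵥ planeVec i j c d = ((a * c + b * d : ℝ) : ℂ) := by
  simp [planeVec, hij, hij.symm]

lemma rankOne_planeVec_mulVec {i j : ι} (hij : i ≠ j) (a b c d : ℝ) :
    rankOne (planeVec i j a b) *ᵥ planeVec i j c d =
      planeVec i j ((a * c + b * d) * a) ((a * c + b * d) * b) := by
  rw [rankOne_mulVec, star_planeVec_dotProduct hij]
  ext k
  simp only [planeVec, Pi.smul_apply, Pi.add_apply, Pi.single_apply, smul_eq_mul]
  split_ifs <;> push_cast <;> ring

lemma smul_planeVec {ι : Type*} [DecidableEq ι] (i j : ι) (l a b : ℝ) :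
    (l : ℂ) • planeVec i j a b = planeVec i j (l * a) (l * b) := by
  ext k
  simp only [planeVec, Pi.smul_apply, Pi.add_apply, Pi.single_apply, smul_eq_mul]
  split_ifs <;> push_cast <;> ring

lemma smul_planeVec_real {ι : Type*} [DecidableEq ι] (i j : ι) (l a b : ℝ) :
    l • planeVec i j a b = planeVec i j (l * a) (l * b) := smul_planeVec i j l a b

lemma planeVec_add {ι : Type*} [DecidableEq ι] (i j : ι) (a b c d : ℝ) :
    planeVec i j a b + planeVec i j c d = planeVec i j (a + c) (b + d) := by
  ext k
  simp only [planeVec, Pi.add_apply, Pi.single_apply]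
  split_ifs <;> push_cast <;> ring

lemma planeVec_one_zero {ι : Type*} [DecidableEq ι] (i j : ι) : planeVec i j 1 0 = Pi.single i 1 := by
  simp [planeVec]

lemma planeVec_apply_left {ι : Type*} [DecidableEq ι] {i j : ι} (hij : i ≠ j) (a b : ℝ) :
    planeVec i j a b i = a := by
  simp [planeVec, hij]

/-- The value of `⟨e_i, X^p e_i⟩` for a matrix acting on the span of `e_i` and `e_j` with given
eigenvectors. -/
lemma diagPow_eq_of_planeVec {X : Matrix ι ι ℂ} (hX : X.PosSemidef) (p : ℝ) {i j : ι} (hij : i ≠ j)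
    {v₁ v₂ w₁ w₂ l m c d : ℝ} (hl : 0 ≤ l) (hm : 0 ≤ m)
    (hv : X *ᵥ planeVec i j v₁ v₂ = planeVec i j (l * v₁) (l * v₂))
    (hw : X *ᵥ planeVec i j w₁ w₂ = planeVec i j (m * w₁) (m * w₂))
    (h₁ : c * v₁ + d * w₁ = 1) (h₂ : c * v₂ + d * w₂ = 0) :
    diagPow p i X = c * l ^ p * v₁ + d * m ^ p * w₁ := by
  rw [diagPow_eq_of_eigenvectors hX p i hl hm (hv.trans (smul_planeVec ..).symm)
    (hw.trans (smul_planeVec ..).symm) (c := c) (d := d) (by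
      rw [smul_planeVec, smul_planeVec, planeVec_add, h₁, h₂, planeVec_one_zero]),
    planeVec_apply_left hij, planeVec_apply_left hij, Complex.ofReal_re, Complex.ofReal_re]

lemma diagPow_rankOne_one {p : ℝ} (hp : 0 < p) {i j : ι} (hij : i ≠ j) {s : ℝ} (hs : s * s = 1) :
    diagPow p i (rankOne (planeVec i j 1 s)) = 2 ^ p / 2 := by
  rw [diagPow_eq_of_planeVec (rankOne_posSemidef _) p hij (v₁ := 1) (v₂ := s) (w₁ := 1) (w₂ := -s)
    (l := 2) (m := 0) (c := 1 / 2) (d := 1 / 2) (by norm_num) le_rfl ?_ ?_ (by ring) (by ring),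
    Real.zero_rpow hp.ne']
  · ring
  · rw [rankOne_planeVec_mulVec hij, hs]; norm_num
  · rw [rankOne_planeVec_mulVec hij]
    have : (1 : ℝ) * 1 + s * -s = 0 := by linarith
    rw [this]; norm_num

lemma diagPow_rankOne_right {p : ℝ} (hp : 0 < p) {i j : ι} (hij : i ≠ j) :
    diagPow p i (rankOne (planeVec i j 0 1)) = 0 := by
  rw [diagPow_eq_of_planeVec (rankOne_posSemidef _) p hij (v₁ := 1) (v₂ := 0) (w₁ := 0) (w₂ := 1)
    (l := 0) (m := 1) (c := 1) (d := 0) le_rfl zero_le_one ?_ ?_ (by ring) (by ring),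
    Real.zero_rpow hp.ne']
  · ring
  · rw [rankOne_planeVec_mulVec hij]; norm_num
  · rw [rankOne_planeVec_mulVec hij]; norm_num

lemma diagPow_rankOne_left {p : ℝ} {i j : ι} (hij : i ≠ j) :
    diagPow p i (rankOne (planeVec i j 1 0)) = 1 := by
  rw [diagPow_eq_of_planeVec (rankOne_posSemidef _) p hij (v₁ := 1) (v₂ := 0) (w₁ := 0) (w₂ := 1)
    (l := 1) (m := 0) (c := 1) (d := 0) zero_le_one le_rfl ?_ ?_ (by ring) (by ring),
    Real.one_rpow]
  · ring
  · rw [rankOne_planeVec_mulVec hij]; norm_num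
  · rw [rankOne_planeVec_mulVec hij]; norm_num

/-- On the plane the matrix has rows (1, 1) and (1, 5/2), with eigenvalues 3 and 1/2 on the
orthogonal vectors (1, 2) and (2, -1). -/
lemma diagPow_rankOne_add {p : ℝ} {i j : ι} (hij : i ≠ j) :
    diagPow p i (rankOne (planeVec i j 1 1) + (3 / 2 : ℝ) • rankOne (planeVec i j 0 1)) =
      3 / 5 * 3 ^ (p - 1) + 2 / 5 * (1 / 2) ^ (p - 1) := by
  rw [diagPow_eq_of_planeVec ((rankOne_posSemidef _).add ((rankOne_posSemidef _).smul (by norm_num)))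
    p hij (v₁ := 1) (v₂ := 2) (w₁ := 2) (w₂ := -1) (l := 3) (m := 1 / 2) (c := 1 / 5) (d := 2 / 5)
    (by norm_num) (by norm_num) ?_ ?_ (by norm_num) (by norm_num),
    Real.rpow_sub_one (by norm_num), Real.rpow_sub_one (by norm_num)]
  · ring
  · rw [add_mulVec, smul_mulVec, rankOne_planeVec_mulVec hij, rankOne_planeVec_mulVec hij,
      smul_planeVec_real, planeVec_add]
    norm_num
  · rw [add_mulVec, smul_mulVec, rankOne_planeVec_mulVec hij, rankOne_planeVec_mulVec hij,
      smul_planeVec_real, planeVec_add]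
    norm_num

/-- Strict Jensen for x^(p-1), as p - 1 > 1. Weight each eigenvalue l of M by l|⟨e_i, v⟩|²: the mass
M_ii = 1 and the mean (M²)_ii = 2 depend only on column i, so adding a multiple of e_j e_j* to the
rank one matrix of (1, 1) preserves both but spreads the mass from 2 to {3, 1/2}. -/
lemma two_rpow_lt {p : ℝ} (hp : 2 < p) :
    (2 : ℝ) ^ p / 2 < 3 / 5 * 3 ^ (p - 1) + 2 / 5 * (1 / 2) ^ (p - 1) := by
  have h := (strictConvexOn_rpow (by linarith : 1 < p - 1)).2
    (by norm_num : (3 : ℝ) ∈ Set.Ici 0) (by norm_num : (1 / 2 : ℝ) ∈ Set.Ici 0) (by norm_num)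
    (by norm_num : (0 : ℝ) < 3 / 5) (by norm_num : (0 : ℝ) < 2 / 5) (by norm_num)
  simp only [smul_eq_mul] at h
  rw [show (3 / 5 * 3 + 2 / 5 * (1 / 2) : ℝ) = 2 by norm_num, Real.rpow_sub_one (by norm_num)] at h
  exact h

/-- For `p > 2` the function `X ↦ ⟨e_i, X^p e_i⟩` is not quasiconvex. -/
lemma exists_diagPow_lt {p : ℝ} (hp : 2 < p) {i j : ι} (hij : i ≠ j) :
    ∃ X Y : Matrix ι ι ℂ, X.PosSemidef ∧ Y.PosSemidef ∧ ∃ a b : ℝ, 0 ≤ a ∧ 0 ≤ b ∧ a + b = 1 ∧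
      diagPow p i Y = 0 ∧ diagPow p i X < diagPow p i (a • X + b • Y) := by
  have hp0 : 0 < p := by linarith
  -- To write the sum as a convex combination, the rank one matrix is enlarged by c > 1, close
  -- enough to 1 to keep the strict inequality; the remaining weight 1 - 1/c is compensated by
  -- enlarging Y, which costs nothing since its entry is 0.
  obtain ⟨c, hc, hc1⟩ : ∃ c : ℝ, c ^ p * (2 ^ p / 2) <
      3 / 5 * 3 ^ (p - 1) + 2 / 5 * (1 / 2) ^ (p - 1) ∧ 1 < c := by
    have hlim : ContinuousAt (fun c : ℝ => c ^ p * (2 ^ p / 2)) 1 :=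
      (Real.continuousAt_rpow_const 1 p (Or.inr hp0.le)).mul continuousAt_const
    have h : ∀ᶠ c : ℝ in nhds 1, c ^ p * (2 ^ p / 2) <
        3 / 5 * 3 ^ (p - 1) + 2 / 5 * (1 / 2) ^ (p - 1) :=
      hlim.eventually_lt_const (by simpa using two_rpow_lt hp)
    exact ((h.filter_mono nhdsWithin_le_nhds).and
      (self_mem_nhdsWithin : Set.Ioi (1 : ℝ) ∈ nhdsWithin 1 (Set.Ioi 1))).exists
  have hc0 : 0 < c := by linarith
  have hd : 0 < 1 - c⁻¹ := sub_pos.mpr (inv_lt_one_of_one_lt₀ hc1)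
  have hd' : 0 ≤ (3 / 2) / (1 - c⁻¹) := by positivity
  refine ⟨c • rankOne (planeVec i j 1 1), ((3 / 2) / (1 - c⁻¹)) • rankOne (planeVec i j 0 1),
    (rankOne_posSemidef _).smul hc0.le, (rankOne_posSemidef _).smul hd', c⁻¹, 1 - c⁻¹,
    by positivity, hd.le, by ring, ?_, ?_⟩
  · rw [diagPow_smul p i (rankOne_posSemidef _) hd', diagPow_rankOne_right hp0 hij, mul_zero]
  · rw [smul_smul, smul_smul, inv_mul_cancel₀ hc0.ne', one_smul, mul_div_cancel₀ _ hd.ne',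
      diagPow_rankOne_add hij, diagPow_smul p i (rankOne_posSemidef _) hc0.le,
      diagPow_rankOne_one hp0 hij (by norm_num)]
    exact hc

/-- The compression by the projection on e_i has a single possibly nonzero entry, and 0^(q/p) = 0.
-/
lemma upsilon_single {n : ℕ} {p q : ℝ} (hp : 0 < p) (hq : 0 < q) (i : Fin n)
    (X : Matrix (Fin n) (Fin n) ℂ) :
    Upsilon p q (diagonal (Pi.single i 1)) X = diagPow p i X ^ (q / p) := by
  have hr : q / p ≠ 0 := (div_pos hq hp).ne'
  have h : (diagonal (Pi.single i (1 : ℂ)))ᴴ * X ^ p * diagonal (Pi.single i 1) =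
      diagonal fun k => (((Pi.single i (diagPow p i X) : Fin n → ℝ) k : ℝ) : ℂ) := by
    ext k l
    rw [diagonal_conjTranspose, mul_diagonal, diagonal_mul]
    rcases eq_or_ne k i with rfl | hk
    · rcases eq_or_ne k l with rfl | hl
      · simp [rpow_diag_eq]
      · simp [hl, hl.symm]
    · simp [hk, diagonal_apply]
  rw [Upsilon, h, diagonal_rpow, trace_diagonal, Complex.re_sum, Finset.sum_eq_single i]
  · simp
  · intro k _ hk
    simp [hk, Real.zero_rpow hr]
  · simp
  · intro k
    rcases eq_or_ne k i with rfl | hk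
    · simpa using diagPow_nonneg p k X
    · simp [hk]

/-- For `p > 2` and a rank one projection `B` in a coordinate direction, `Υ` is neither convex nor
concave. -/
theorem upsilon_not_convex_not_concave {p q : ℝ} (hp : 2 < p) (hq : 0 < q) {n : ℕ} (hn : 2 ≤ n) :
    ∃ B : Matrix (Fin n) (Fin n) ℂ, ¬ ConvexOn ℝ (psdCone (Fin n)) (Upsilon p q B) ∧
      ¬ ConcaveOn ℝ (psdCone (Fin n)) (Upsilon p q B) := by
  have hp0 : 0 < p := by linarith
  have hr : 0 < q / p := div_pos hq hp0
  have hij : (⟨0, by omega⟩ : Fin n) ≠ ⟨1, by omega⟩ := by simp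
  generalize (⟨0, by omega⟩ : Fin n) = i at hij
  generalize (⟨1, by omega⟩ : Fin n) = j at hij
  refine ⟨diagonal (Pi.single i 1), fun h => ?_, fun h => ?_⟩
  · obtain ⟨X, Y, hX, hY, a, b, ha, hb, hab, h0, hlt⟩ := exists_diagPow_lt hp hij
    have h1 := h.2 hX hY ha hb hab
    simp only [upsilon_single hp0 hq, h0, Real.zero_rpow hr.ne', smul_eq_mul, mul_zero,
      add_zero] at h1
    have h2 := Real.rpow_lt_rpow (diagPow_nonneg p i X) hlt hr
    have h3 : a * diagPow p i X ^ (q / p) ≤ diagPow p i X ^ (q / p) :=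
      mul_le_of_le_one_left (Real.rpow_nonneg (diagPow_nonneg p i X) _) (by linarith)
    linarith
  -- Υ has degree q, possibly at most 1, so scaling alone cannot refute concavity. The rank one
  -- matrices of (1, 1) and (1, -1) average to the identity of the plane, with value 1, below
  -- (2^p/2)^(q/p).
  · have h1 := h.2 (rankOne_posSemidef (planeVec i j 1 1)) (rankOne_posSemidef (planeVec i j 1 (-1)))
      (by norm_num : (0 : ℝ) ≤ 1 / 2) (by norm_num : (0 : ℝ) ≤ 1 / 2) (by norm_num)
    have hmid : diagPow p i ((1 / 2 : ℝ) • rankOne (planeVec i j 1 1) +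
        (1 / 2 : ℝ) • rankOne (planeVec i j 1 (-1))) = 1 := by
      rw [diagPow_eq_of_planeVec (posSemidef_combo (rankOne_posSemidef _) (rankOne_posSemidef _)
        (by norm_num) (by norm_num)) p hij (v₁ := 1) (v₂ := 0) (w₁ := 0) (w₂ := 1) (l := 1)
        (m := 1) (c := 1) (d := 0) zero_le_one zero_le_one ?_ ?_ (by ring) (by ring), Real.one_rpow]
      · ring
      all_goals
        rw [add_mulVec, smul_mulVec, smul_mulVec, rankOne_planeVec_mulVec hij,
          rankOne_planeVec_mulVec hij, smul_planeVec_real, smul_planeVec_real, planeVec_add]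
        norm_num
    simp only [upsilon_single hp0 hq, hmid, diagPow_rankOne_one hp0 hij (show (1 : ℝ) * 1 = 1 by
      norm_num), diagPow_rankOne_one hp0 hij (show (-1 : ℝ) * (-1) = 1 by norm_num), Real.one_rpow,
      smul_eq_mul] at h1
    have h2 : (1 : ℝ) < 2 ^ p / 2 := by
      have := Real.rpow_lt_rpow_of_exponent_lt (by norm_num : (1 : ℝ) < 2) (by linarith : 1 < p)
      rw [Real.rpow_one] at this
      linarith
    have h3 := Real.one_lt_rpow h2 hr
    linarith

end

/-! ### Failure for p > 2: first order expansion, Φ and Ψ -/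

section

variable {ι κ : Type*} [Fintype ι] [DecidableEq ι] [Fintype κ] [DecidableEq κ]

open scoped Matrix.Norms.L2Operator in
lemma continuousOn_rpow_posDef (r : ℝ) :
    ContinuousOn (fun X : Matrix ι ι ℂ => X ^ r) {X | X.PosDef} := by
  have := CFC.continuousOn_rpow (A := Matrix ι ι ℂ) r
  simpa only [isStrictlyPositive_iff_posDef] using this

lemma mul_rpow_sub_one_of_posDef {X : Matrix ι ι ℂ} (hX : X.PosDef) (r : ℝ) :
    X * X ^ (r - 1) = X ^ r := by
  have := CFC.rpow_add (a := X) (x := 1) (y := r - 1) hX.isUnit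
  rw [CFC.rpow_one X (nonneg_iff_posSemidef.mpr hX.posSemidef), add_sub_cancel] at this
  exact this.symm

/-- The one-sided derivative of `y ↦ Tr (C + y Y)^r` at `0`. -/
lemma hasDerivWithinAt_trPow {C Y : Matrix ι ι ℂ} (hC : C.PosDef) (hY : Y.PosSemidef) {r : ℝ}
    (hr : 0 < r) :
    HasDerivWithinAt (fun y : ℝ => trPow r (C + y • Y)) (r * (trace (Y * C ^ (r - 1))).re)
      (Set.Ioi 0) 0 := by
  rw [hasDerivWithinAt_iff_tendsto_slope' (by simp)]
  have hpd (y : ℝ) (hy : 0 ≤ y) : (C + y • Y).PosDef := hC.add_posSemidef (hY.smul hy)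
  have hlim : Filter.Tendsto (fun y : ℝ => r * (trace (Y * (C + y • Y) ^ (r - 1))).re)
      (nhdsWithin 0 (Set.Ioi 0)) (nhds (r * (trace (Y * C ^ (r - 1))).re)) := by
    have hc : ContinuousOn (fun y : ℝ => (C + y • Y) ^ (r - 1)) (Set.Ici 0) :=
      (continuousOn_rpow_posDef (r - 1)).comp (by fun_prop) fun y hy => hpd y hy
    have h0 := (hc 0 (Set.self_mem_Ici)).mono Set.Ioi_subset_Ici_self
    have h1 : Continuous fun M : Matrix ι ι ℂ => r * (trace (Y * M)).re := by fun_prop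
    have := (h1.tendsto _).comp h0.tendsto
    simpa only [zero_smul, add_zero, Function.comp_def] using this
  have hslope (y : ℝ) : slope (fun y : ℝ => trPow r (C + y • Y)) 0 y =
      (trPow r (C + y • Y) - trPow r C) / y := by
    simp [slope_def_field]
  have expand (y : ℝ) (M : Matrix ι ι ℂ) : (trace ((C + y • Y) * M)).re =
      (trace (C * M)).re + y * (trace (Y * M)).re := by
    simp [Matrix.add_mul, trace_add]
  have tr (y : ℝ) (hy : 0 ≤ y) : trPow r (C + y • Y) =
      (trace (C * (C + y • Y) ^ (r - 1))).re + y * (trace (Y * (C + y • Y) ^ (r - 1))).re := by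
    rw [← expand, mul_rpow_sub_one_of_posDef (hpd y hy), trPow]
  have trC : (trace (C * C ^ (r - 1))).re = trPow r C := by
    rw [mul_rpow_sub_one_of_posDef hC, trPow]
  -- Klein's inequality with the roles of C and C + yY exchanged traps the difference quotient
  -- between r Tr[Y C^(r-1)] and r Tr[Y (C + yY)^(r-1)], in an order depending on r ≥ 1 or r ≤ 1;
  -- the latter bound converges by continuity.
  rcases le_total 1 r with h1 | h1
  · refine tendsto_of_tendsto_of_tendsto_of_le_of_le' tendsto_const_nhds hlim
      (Filter.eventually_of_mem self_mem_nhdsWithin fun y hy => ?_)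
      (Filter.eventually_of_mem self_mem_nhdsWithin fun y hy => ?_)
    all_goals
      have hy : 0 < y := hy
      rw [hslope]
    · rw [le_div_iff₀ hy]
      have := klein_of_one_le (hpd y hy.le).posSemidef hC.posSemidef h1
      rw [expand, trC] at this
      linarith
    · rw [div_le_iff₀ hy]
      have := klein_of_one_le hC.posSemidef (hpd y hy.le).posSemidef h1
      have e := tr y hy.le
      have e' : r * (trace (C * (C + y • Y) ^ (r - 1))).re = r * trPow r (C + y • Y) -
          r * (y * (trace (Y * (C + y • Y) ^ (r - 1))).re) := by rw [e]; ring
      rw [e'] at this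
      linarith
  · refine tendsto_of_tendsto_of_tendsto_of_le_of_le' hlim tendsto_const_nhds
      (Filter.eventually_of_mem self_mem_nhdsWithin fun y hy => ?_)
      (Filter.eventually_of_mem self_mem_nhdsWithin fun y hy => ?_)
    all_goals
      have hy : 0 < y := hy
      rw [hslope]
    · rw [le_div_iff₀ hy]
      have := klein_of_le_one hC.posSemidef (hpd y hy.le) hr.le h1
      have e := tr y hy.le
      have e' : r * (trace (C * (C + y • Y) ^ (r - 1))).re = r * trPow r (C + y • Y) -
          r * (y * (trace (Y * (C + y • Y) ^ (r - 1))).re) := by rw [e]; ring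
      rw [e'] at this
      linarith
    · rw [div_le_iff₀ hy]
      have := klein_of_le_one (hpd y hy.le).posSemidef hC hr.le h1
      rw [expand, trC] at this
      linarith

lemma trPow_pos [Nonempty ι] {C : Matrix ι ι ℂ} (hC : C.PosDef) (r : ℝ) : 0 < trPow r C :=
  (Complex.pos_iff.mp (rpow_posDef hC r).trace_pos).1

/-- A function that vanishes at `0` and is nonnegative on `(0, ∞)` has a nonnegative one-sided
derivative at `0`. -/
lemma nonneg_of_hasDerivWithinAt {f : ℝ → ℝ} {d : ℝ} (hf : HasDerivWithinAt f d (Set.Ioi 0) 0)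
    (h0 : f 0 = 0) (h : ∀ y, 0 < y → 0 ≤ f y) : 0 ≤ d := by
  rw [hasDerivWithinAt_iff_tendsto_slope' (by simp)] at hf
  refine ge_of_tendsto hf (Filter.eventually_of_mem self_mem_nhdsWithin fun y hy => ?_)
  have hy : 0 < y := hy
  rw [slope_def_field, h0, sub_zero, sub_zero]
  exact div_nonneg (h y hy) hy.le

/-- The function `X ↦ (Tr (C + X^p)^{q/p})^{1/q}`. -/
def shifted (p q : ℝ) (C X : Matrix ι ι ℂ) : ℝ := trPow (q / p) (C + X ^ p) ^ (1 / q)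

/-- The scaling y^(1/p) makes the p-th power linear in y, so Tr[X^p C^(q/p-1)] appears at first
order. -/
lemma hasDerivWithinAt_shifted [Nonempty ι] {p q : ℝ} (hp : 0 < p) (hq : 0 < q)
    {C X : Matrix ι ι ℂ} (hC : C.PosDef) (hX : X.PosSemidef) :
    HasDerivWithinAt (fun y : ℝ => shifted p q C (y ^ (1 / p) • X))
      (q / p * (1 / q) * trPow (q / p) C ^ (1 / q - 1) * (trace (X ^ p * C ^ (q / p - 1))).re)
      (Set.Ioi 0) 0 := by
  have h := (hasDerivWithinAt_trPow hC (rpow_posSemidef X p) (div_pos hq hp)).rpow_const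
    (p := 1 / q) (Or.inl (by simpa using (trPow_pos hC _).ne'))
  simp only [zero_smul, add_zero] at h
  have e (y : ℝ) (hy : 0 ≤ y) : shifted p q C (y ^ (1 / p) • X) =
      trPow (q / p) (C + y • X ^ p) ^ (1 / q) := by
    rw [shifted, smul_rpow hX (Real.rpow_nonneg hy _), ← Real.rpow_mul hy,
      one_div_mul_cancel hp.ne', Real.rpow_one]
  refine (h.congr (fun y hy => e y (le_of_lt hy)) (e 0 le_rfl)).congr_deriv ?_
  ring

/-- Convexity of `shifted p q C` forces convexity of its leading term `X ↦ Tr[X^p C^{q/p-1}]`. -/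
lemma re_trace_rpow_convex_of_shifted [Nonempty ι] {p q : ℝ} (hp : 0 < p) (hq : 0 < q)
    {C : Matrix ι ι ℂ} (hC : C.PosDef) (h : ConvexOn ℝ (psdCone ι) (shifted p q C))
    {X Y : Matrix ι ι ℂ} (hX : X.PosSemidef) (hY : Y.PosSemidef) {a b : ℝ} (ha : 0 ≤ a)
    (hb : 0 ≤ b) (hab : a + b = 1) :
    (trace ((a • X + b • Y) ^ p * C ^ (q / p - 1))).re ≤
      a * (trace (X ^ p * C ^ (q / p - 1))).re + b * (trace (Y ^ p * C ^ (q / p - 1))).re := by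
  -- The convexity gap along the scaling vanishes at y = 0 and is nonnegative for y > 0, so its
  -- derivative is nonnegative; that derivative is a positive constant times the gap of the leading
  -- term.
  have hd := (((hasDerivWithinAt_shifted hp hq hC hX).const_mul a).add
    ((hasDerivWithinAt_shifted hp hq hC hY).const_mul b)).sub
    (hasDerivWithinAt_shifted hp hq hC (posSemidef_combo hX hY ha hb))
  have hn := nonneg_of_hasDerivWithinAt hd ?_ ?_
  · have hc : 0 < q / p * (1 / q) * trPow (q / p) C ^ (1 / q - 1) :=
      mul_pos (by positivity) (Real.rpow_pos_of_pos (trPow_pos hC _) _)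
    rw [← sub_nonneg]
    refine nonneg_of_mul_nonneg_right (hn.trans_eq ?_) hc
    ring
  · simp only [Pi.sub_apply, Pi.add_apply, Real.zero_rpow (one_div_ne_zero hp.ne'), zero_smul]
    rw [← add_mul, hab, one_mul, sub_self]
  · intro y hy
    have := h.2 (hX.smul (Real.rpow_nonneg hy.le (1 / p))) (hY.smul (Real.rpow_nonneg hy.le (1 / p)))
      ha hb hab
    rw [smul_comm a, smul_comm b, ← smul_add] at this
    simpa using this

/-- Concavity of `shifted p q C` forces concavity of its leading term `X ↦ Tr[X^p C^{q/p-1}]`. -/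
lemma re_trace_rpow_concave_of_shifted [Nonempty ι] {p q : ℝ} (hp : 0 < p) (hq : 0 < q)
    {C : Matrix ι ι ℂ} (hC : C.PosDef) (h : ConcaveOn ℝ (psdCone ι) (shifted p q C))
    {X Y : Matrix ι ι ℂ} (hX : X.PosSemidef) (hY : Y.PosSemidef) {a b : ℝ} (ha : 0 ≤ a)
    (hb : 0 ≤ b) (hab : a + b = 1) :
    a * (trace (X ^ p * C ^ (q / p - 1))).re + b * (trace (Y ^ p * C ^ (q / p - 1))).re ≤
      (trace ((a • X + b • Y) ^ p * C ^ (q / p - 1))).re := by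
  have hd := (hasDerivWithinAt_shifted hp hq hC (posSemidef_combo hX hY ha hb)).sub
    (((hasDerivWithinAt_shifted hp hq hC hX).const_mul a).add
    ((hasDerivWithinAt_shifted hp hq hC hY).const_mul b))
  have hn := nonneg_of_hasDerivWithinAt hd ?_ ?_
  · have hc : 0 < q / p * (1 / q) * trPow (q / p) C ^ (1 / q - 1) :=
      mul_pos (by positivity) (Real.rpow_pos_of_pos (trPow_pos hC _) _)
    rw [← sub_nonneg]
    refine nonneg_of_mul_nonneg_right (hn.trans_eq ?_) hc
    ring
  · simp only [Pi.sub_apply, Pi.add_apply, Real.zero_rpow (one_div_ne_zero hp.ne'), zero_smul]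
    rw [← add_mul, hab, one_mul, sub_self]
  · intro y hy
    have := h.2 (hX.smul (Real.rpow_nonneg hy.le (1 / p))) (hY.smul (Real.rpow_nonneg hy.le (1 / p)))
      ha hb hab
    rw [smul_comm a, smul_comm b, ← smul_add] at this
    simpa using this

lemma re_trace_rpow_mul_diagonal (p : ℝ) (X : Matrix ι ι ℂ) (d : ι → ℝ) :
    (trace (X ^ p * diagonal fun k => (d k : ℂ))).re = ∑ k, diagPow p k X * d k := by
  simp only [trace, diag_apply, mul_diagonal, Complex.re_sum, rpow_diag_eq, ← Complex.ofReal_mul,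
    Complex.ofReal_re]

/-- For `p > 2` and `q ≠ p` there is a positive definite shift for which `shifted p q C` is neither
convex nor concave. -/
theorem exists_shifted_not_convex_not_concave {p q : ℝ} (hp : 2 < p) (hq : 0 < q) (hqp : q ≠ p)
    {i j : ι} (hij : i ≠ j) : ∃ C : Matrix ι ι ℂ, C.PosDef ∧
      ¬ ConvexOn ℝ (psdCone ι) (shifted p q C) ∧ ¬ ConcaveOn ℝ (psdCone ι) (shifted p q C) := by
  have hp0 : 0 < p := by linarith
  have : Nonempty ι := ⟨i⟩
  have hs : q / p - 1 ≠ 0 := by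
    rw [sub_ne_zero, Ne, div_eq_one_iff_eq hp0.ne']; exact hqp
  obtain ⟨X, Y, hX, hY, a, b, ha, hb, hab, h0, hlt⟩ := exists_diagPow_lt hp hij
  set R := ∑ k, diagPow p k X + ∑ k, diagPow p k Y with hR
  have hR0 : 0 ≤ R := add_nonneg (Finset.sum_nonneg fun k _ => diagPow_nonneg p k X)
    (Finset.sum_nonneg fun k _ => diagPow_nonneg p k Y)
  -- Small enough that the diagonal entries other than i, weighted by δ, cannot close the gap at i;
  -- the + 1 avoids division by zero.
  set δ := (diagPow p i (a • X + b • Y) - diagPow p i X) / (R + 1) with hδ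
  have hδ0 : 0 < δ := div_pos (by linarith) (by linarith)
  have hδR : δ * R < diagPow p i (a • X + b • Y) - diagPow p i X := by
    have : δ * (R + 1) = diagPow p i (a • X + b • Y) - diagPow p i X :=
      div_mul_cancel₀ _ (by linarith)
    linarith
  -- the weights of the leading term, and the shift that produces them
  let d : ι → ℝ := fun k => if k = i then 1 else δ
  have hd (k : ι) : 0 < d k := by
    simp only [d]; split_ifs <;> [exact one_pos; exact hδ0]
  -- Solves C^(q/p-1) = diag(d); this needs q ≠ p.
  let c : ι → ℝ := fun k => d k ^ (q / p - 1)⁻¹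
  have hc (k : ι) : 0 < c k := Real.rpow_pos_of_pos (hd k) _
  have hC : (diagonal fun k => (c k : ℂ)).PosDef :=
    PosDef.diagonal fun k => by simpa using hc k
  have hCpow : (diagonal fun k => (c k : ℂ)) ^ (q / p - 1) = diagonal fun k => (d k : ℂ) := by
    rw [diagonal_rpow fun k => (hc k).le]
    congr! 3 with k
    rw [← Real.rpow_mul (hd k).le, inv_mul_cancel₀ hs, Real.rpow_one]
  have lower (Z : Matrix ι ι ℂ) : diagPow p i Z ≤ ∑ k, diagPow p k Z * d k := by
    have := Finset.single_le_sum (f := fun k => diagPow p k Z * d k)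
      (fun k _ => mul_nonneg (diagPow_nonneg p k Z) (hd k).le) (Finset.mem_univ i)
    simpa [d] using this
  have upper (Z : Matrix ι ι ℂ) :
      ∑ k, diagPow p k Z * d k ≤ diagPow p i Z + δ * ∑ k, diagPow p k Z := by
    have h1 : ∀ k, diagPow p k Z * d k ≤
        (if k = i then diagPow p k Z else 0) + δ * diagPow p k Z := by
      intro k
      have hk := mul_nonneg hδ0.le (diagPow_nonneg p k Z)
      simp only [d]
      split_ifs <;> linarith
    refine (Finset.sum_le_sum fun k _ => h1 k).trans_eq ?_
    rw [Finset.sum_add_distrib, ← Finset.mul_sum]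
    simp
  refine ⟨_, hC, fun h => ?_, fun h => ?_⟩
  · have h1 := re_trace_rpow_convex_of_shifted hp0 hq hC h hX hY ha hb hab
    rw [hCpow, re_trace_rpow_mul_diagonal, re_trace_rpow_mul_diagonal,
      re_trace_rpow_mul_diagonal] at h1
    have h2 := lower (a • X + b • Y)
    have nonneg (Z : Matrix ι ι ℂ) : 0 ≤ ∑ k, diagPow p k Z * d k :=
      Finset.sum_nonneg fun k _ => mul_nonneg (diagPow_nonneg p k Z) (hd k).le
    have h3 := mul_le_of_le_one_left (nonneg X) (by linarith : a ≤ 1)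
    have h4 := mul_le_of_le_one_left (nonneg Y) (by linarith : b ≤ 1)
    have h5 := upper X
    have h6 := upper Y
    rw [h0] at h6
    rw [hR] at hδR
    linarith
  -- The leading term has degree p > 1 whatever q is, and is positive at this matrix, so concavity
  -- fails on the segment to 0.
  · have hP := rankOne_posSemidef (planeVec i j 1 0)
    have h1 := re_trace_rpow_concave_of_shifted hp0 hq hC h hP (PosSemidef.zero)
      (by norm_num : (0 : ℝ) ≤ 1 / 2) (by norm_num : (0 : ℝ) ≤ 1 / 2) (by norm_num)
    rw [hCpow, re_trace_rpow_mul_diagonal, re_trace_rpow_mul_diagonal,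
      re_trace_rpow_mul_diagonal, smul_zero, add_zero] at h1
    simp only [diagPow_smul p _ hP (by norm_num : (0 : ℝ) ≤ 1 / 2), mul_assoc,
      ← Finset.mul_sum] at h1
    have h2 : 0 ≤ ∑ k, diagPow p k (0 : Matrix ι ι ℂ) * d k :=
      Finset.sum_nonneg fun k _ => mul_nonneg (diagPow_nonneg p k _) (hd k).le
    have h3 := lower (rankOne (planeVec i j 1 0))
    rw [diagPow_rankOne_left hij] at h3
    have h4 : (1 / 2 : ℝ) ^ p < 1 / 2 := by
      simpa using Real.rpow_lt_rpow_of_exponent_gt (by norm_num : (0 : ℝ) < 1 / 2) (by norm_num)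
        (by linarith : 1 < p)
    nlinarith

/-- The argument C^(1/p) in a slot l ≠ j contributes C to the sum of p-th powers, and the zeros
contribute nothing: this realises the shift. -/
lemma phi_update_single {m n : ℕ} {p q : ℝ} (hp : 0 < p) (hq : 0 < q) {j l : Fin m} (hjl : l ≠ j)
    {C : Matrix (Fin n) (Fin n) ℂ} (hC : C.PosSemidef) (X : Matrix (Fin n) (Fin n) ℂ) :
    Phi p q (Function.update (Pi.single l (C ^ (1 / p))) j X) = shifted p q C X := by
  have hsum : ∑ k, Function.update (Pi.single l (C ^ (1 / p)) : Fin m → Matrix (Fin n) (Fin n) ℂ)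
      j X k ^ p = C + X ^ p := by
    simp only [Function.apply_update (fun _ (M : Matrix (Fin n) (Fin n) ℂ) => M ^ p)]
    rw [Finset.sum_update_of_mem (Finset.mem_univ j), Finset.sum_eq_single l, Pi.single_eq_same,
      rpow_rpow hC _ _ (by positivity) hp.le, one_div_mul_cancel hp.ne',
      CFC.rpow_one C (nonneg_iff_posSemidef.mpr hC), add_comm]
    · intro k _ hk
      rw [Pi.single_eq_of_ne hk]
      exact CFC.zero_rpow hp.ne'
    · intro h
      exact absurd (by simpa using hjl) h
  rw [Phi, hsum, schatten_rpow (hC.add (rpow_posSemidef X p)) hp hq, shifted]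

theorem phi_not_separately_convex_not_concave {p q : ℝ} (hp : 2 < p) (hq : 0 < q) (hqp : q ≠ p)
    {m n : ℕ} (hm : 2 ≤ m) (hn : 2 ≤ n) (j : Fin m) :
    ∃ A ∈ Set.univ.pi fun _ : Fin m => psdCone (Fin n),
      ¬ ConvexOn ℝ (psdCone (Fin n)) (fun X => Phi p q (Function.update A j X)) ∧
      ¬ ConcaveOn ℝ (psdCone (Fin n)) (fun X => Phi p q (Function.update A j X)) := by
  have : Nontrivial (Fin m) := Fin.nontrivial_iff_two_le.mpr hm
  have : Nontrivial (Fin n) := Fin.nontrivial_iff_two_le.mpr hn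
  obtain ⟨l, hl⟩ := exists_ne j
  obtain ⟨i, k, hik⟩ := exists_pair_ne (Fin n)
  obtain ⟨C, hC, h1, h2⟩ := exists_shifted_not_convex_not_concave hp hq hqp hik
  refine ⟨Pi.single l (C ^ (1 / p)), fun k _ => ?_, ?_⟩
  · rcases eq_or_ne k l with rfl | hk
    · rw [Pi.single_eq_same]
      exact rpow_posSemidef C _
    · rw [Pi.single_eq_of_ne hk]
      exact PosSemidef.zero
  · simp only [phi_update_single (by linarith : 0 < p) hq hl hC.posSemidef]
    exact ⟨h1, h2⟩

/-- Freezing all arguments but one is an affine map, so joint convexity or concavity would imply the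
separate one. -/
lemma update_combo {m : ℕ} {V : Type*} [AddCommGroup V] [Module ℝ V] (A : Fin m → V) (j : Fin m)
    (X Y : V) {a b : ℝ} (hab : a + b = 1) : Function.update A j (a • X + b • Y) =
      a • Function.update A j X + b • Function.update A j Y := by
  ext k
  rcases eq_or_ne k j with rfl | hk
  · simp
  · simp [hk, ← add_smul, hab]

lemma update_mem {m : ℕ} {V : Type*} {S : Set V} {A : Fin m → V}
    (hA : A ∈ Set.univ.pi fun _ : Fin m => S) (j : Fin m) {X : V} (hX : X ∈ S) :
    Function.update A j X ∈ Set.univ.pi fun _ : Fin m => S := by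
  intro k _
  rcases eq_or_ne k j with rfl | hk
  · simpa using hX
  · simpa [hk] using hA k trivial

theorem phi_not_convex_not_concave {p q : ℝ} (hp : 2 < p) (hq : 0 < q) (hqp : q ≠ p)
    {m n : ℕ} (hm : 2 ≤ m) (hn : 2 ≤ n) :
    ¬ ConvexOn ℝ (Set.univ.pi fun _ : Fin m => psdCone (Fin n)) (Phi p q (m := m) (n := n)) ∧
    ¬ ConcaveOn ℝ (Set.univ.pi fun _ : Fin m => psdCone (Fin n)) (Phi p q (m := m) (n := n)) := by
  obtain ⟨A, hA, h1, h2⟩ := phi_not_separately_convex_not_concave hp hq hqp hm hn ⟨0, by omega⟩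
  refine ⟨fun h => h1 ⟨convex_psdCone _, fun X hX Y hY a b ha hb hab => ?_⟩,
    fun h => h2 ⟨convex_psdCone _, fun X hX Y hY a b ha hb hab => ?_⟩⟩
  · simp only
    rw [update_combo A _ X Y hab]
    exact h.2 (update_mem hA _ hX) (update_mem hA _ hY) ha hb hab
  · simp only
    rw [update_combo A _ X Y hab]
    exact h.2 (update_mem hA _ hX) (update_mem hA _ hY) ha hb hab

lemma sliceIncl_conjTranspose_mul (k l : κ) :
    (sliceIncl ι k)ᴴ * sliceIncl ι l = if k = l then (1 : Matrix ι ι ℂ) else 0 := by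
  ext i j
  simp only [Matrix.mul_apply, conjTranspose_apply, sliceIncl, of_apply, apply_ite star, star_one,
    star_zero, ite_mul, one_mul, zero_mul, Finset.sum_ite_eq', Finset.mem_univ, if_true,
    Prod.mk.injEq]
  by_cases hkl : k = l <;> simp [hkl, Matrix.one_apply]

/-- The block diagonal matrix `∑ A_k ⊗ e_k e_k*` on `ℂ^ι ⊗ ℂ^κ`. -/
def blockSum (ι κ : Type*) [Fintype ι] [DecidableEq ι] [Fintype κ] [DecidableEq κ] :
    (κ → Matrix ι ι ℂ) →ₗ[ℝ] Matrix (ι × κ) (ι × κ) ℂ where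
  toFun A := ∑ k, sliceIncl ι k * A k * (sliceIncl ι k)ᴴ
  map_add' A A' := by simp [Matrix.mul_add, Matrix.add_mul, Finset.sum_add_distrib]
  map_smul' c A := by simp [Finset.smul_sum]

lemma blockSum_posSemidef {A : κ → Matrix ι ι ℂ} (hA : ∀ k, (A k).PosSemidef) :
    (blockSum ι κ A).PosSemidef :=
  posSemidef_sum _ fun k _ => (hA k).mul_mul_conjTranspose_same _

lemma blockSum_mul_sliceIncl (A : κ → Matrix ι ι ℂ) (k : κ) :
    blockSum ι κ A * sliceIncl ι k = sliceIncl ι k * A k := by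
  change (∑ l, sliceIncl ι l * A l * (sliceIncl ι l)ᴴ) * sliceIncl ι k = _
  rw [Matrix.sum_mul, Finset.sum_eq_single k]
  · rw [Matrix.mul_assoc, sliceIncl_conjTranspose_mul, if_pos rfl, Matrix.mul_one]
  · intro l _ hl
    rw [Matrix.mul_assoc, sliceIncl_conjTranspose_mul, if_neg hl, Matrix.mul_zero]
  · simp

/-- `sliceIncl` intertwines the block matrix with its k-th block, so the k-th compression of the
p-th power is A_k^p. -/
lemma psi_blockSum {m n : ℕ} (p q : ℝ) {A : Fin n → Matrix (Fin m) (Fin m) ℂ}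
    (hA : ∀ k, (A k).PosSemidef) : Psi p q (blockSum (Fin m) (Fin n) A) = Phi p q A := by
  rw [psi_eq, phi_eq]
  simp only [Function.comp, congrSum, constFamily, LinearMap.coe_mk, AddHom.coe_mk,
    conjTranspose_one, Matrix.one_mul, Matrix.mul_one]
  congr! 4 with k
  rw [Matrix.mul_assoc, rpow_intertwine (blockSum_posSemidef hA) (hA k)
    (blockSum_mul_sliceIncl A k), ← Matrix.mul_assoc, sliceIncl_conjTranspose_mul, if_pos rfl,
    Matrix.one_mul]

theorem psi_not_convex_not_concave {p q : ℝ} (hp : 2 < p) (hq : 0 < q) (hqp : q ≠ p)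
    {m n : ℕ} (hm : 2 ≤ m) (hn : 2 ≤ n) :
    ¬ ConvexOn ℝ (psdCone (Fin m × Fin n)) (Psi p q (m := m) (n := n)) ∧
    ¬ ConcaveOn ℝ (psdCone (Fin m × Fin n)) (Psi p q (m := m) (n := n)) := by
  -- The dimensions swap roles: n blocks of size m.
  obtain ⟨h1, h2⟩ := phi_not_convex_not_concave hp hq hqp hn hm
  have hS : Convex ℝ (Set.univ.pi fun _ : Fin n => psdCone (Fin m)) :=
    convex_pi fun _ _ => convex_psdCone _
  have hsub : (Set.univ.pi fun _ : Fin n => psdCone (Fin m)) ⊆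
      blockSum (Fin m) (Fin n) ⁻¹' psdCone (Fin m × Fin n) :=
    fun A hA => blockSum_posSemidef fun k => hA k trivial
  have heq : Set.EqOn (Psi p q ∘ blockSum (Fin m) (Fin n)) (Phi p q)
      (Set.univ.pi fun _ : Fin n => psdCone (Fin m)) :=
    fun A hA => psi_blockSum p q fun k => hA k trivial
  exact ⟨fun h => h1 (((h.comp_linearMap _).subset hsub hS).congr heq),
    fun h => h2 (((h.comp_linearMap _).subset hsub hS).congr heq)⟩

end

end

end TraceConvexity

theorem theorem1p1 :
    -- `1 ≤ p ≤ 2`, `q ≥ 1`: convexity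
    (∀ p q : ℝ, 1 ≤ p → p ≤ 2 → 1 ≤ q →
      (∀ (n : ℕ) (B : Matrix (Fin n) (Fin n) ℂ),
        ConvexOn ℝ (TraceConvexity.psdCone (Fin n)) (TraceConvexity.Upsilon p q B)) ∧
      (∀ m n : ℕ,
        ConvexOn ℝ (TraceConvexity.psdCone (Fin m × Fin n))
          (TraceConvexity.Psi p q (m := m) (n := n))) ∧
      (∀ m n : ℕ,
        ConvexOn ℝ (Set.univ.pi fun _ : Fin m => TraceConvexity.psdCone (Fin n))
          (TraceConvexity.Phi p q (m := m) (n := n)))) ∧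
    -- `0 < p ≤ q ≤ 1`: concavity
    (∀ p q : ℝ, 0 < p → p ≤ q → q ≤ 1 →
      (∀ (n : ℕ) (B : Matrix (Fin n) (Fin n) ℂ),
        ConcaveOn ℝ (TraceConvexity.psdCone (Fin n)) (TraceConvexity.Upsilon p q B)) ∧
      (∀ m n : ℕ,
        ConcaveOn ℝ (TraceConvexity.psdCone (Fin m × Fin n))
          (TraceConvexity.Psi p q (m := m) (n := n))) ∧
      (∀ m n : ℕ,
        ConcaveOn ℝ (Set.univ.pi fun _ : Fin m => TraceConvexity.psdCone (Fin n))
          (TraceConvexity.Phi p q (m := m) (n := n)))) ∧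
    -- `p > 2`, `q > 0`, `q ≠ p`: neither, already in the smallest nontrivial dimensions
    (∀ p q : ℝ, 2 < p → 0 < q → q ≠ p →
      (∀ n : ℕ, 2 ≤ n → ∃ B : Matrix (Fin n) (Fin n) ℂ,
        ¬ ConvexOn ℝ (TraceConvexity.psdCone (Fin n)) (TraceConvexity.Upsilon p q B) ∧
        ¬ ConcaveOn ℝ (TraceConvexity.psdCone (Fin n)) (TraceConvexity.Upsilon p q B)) ∧
      (∀ m n : ℕ, 2 ≤ m → 2 ≤ n →
        ¬ ConvexOn ℝ (TraceConvexity.psdCone (Fin m × Fin n))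
          (TraceConvexity.Psi p q (m := m) (n := n)) ∧
        ¬ ConcaveOn ℝ (TraceConvexity.psdCone (Fin m × Fin n))
          (TraceConvexity.Psi p q (m := m) (n := n))) ∧
      (∀ m n : ℕ, 2 ≤ m → 2 ≤ n →
        (¬ ConvexOn ℝ (Set.univ.pi fun _ : Fin m => TraceConvexity.psdCone (Fin n))
            (TraceConvexity.Phi p q (m := m) (n := n)) ∧
          ¬ ConcaveOn ℝ (Set.univ.pi fun _ : Fin m => TraceConvexity.psdCone (Fin n))
            (TraceConvexity.Phi p q (m := m) (n := n))) ∧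
        -- not even separately in the `j`-th argument, the other arguments being held fixed
        (∀ j : Fin m, ∃ A ∈ Set.univ.pi fun _ : Fin m => TraceConvexity.psdCone (Fin n),
          ¬ ConvexOn ℝ (TraceConvexity.psdCone (Fin n))
            (fun X => TraceConvexity.Phi p q (Function.update A j X)) ∧
          ¬ ConcaveOn ℝ (TraceConvexity.psdCone (Fin n))
            (fun X => TraceConvexity.Phi p q (Function.update A j X))))) := by
  refine ⟨fun p q hp1 hp hq => TraceConvexity.convexity_of_one_le_of_le_two hp1 hp hq,
    fun p q hp hpq hq => TraceConvexity.concavity_of_le_of_le_one hp hpq hq,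
    fun p q hp hq hqp => ⟨fun n hn => TraceConvexity.upsilon_not_convex_not_concave hp hq hn,
      fun m n hm hn => TraceConvexity.psi_not_convex_not_concave hp hq hqp hm hn,
      fun m n hm hn => ⟨TraceConvexity.phi_not_convex_not_concave hp hq hqp hm hn,
        TraceConvexity.phi_not_separately_convex_not_concave hp hq hqp hm hn⟩⟩⟩
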